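/- Let $\mathcal P$ be a countable set with a map $N:\mathcal P\to\mathbb Z_{>1}$, let $\mathcal M$ be the free abelian monoid generated by $\mathcal P$, write $\mathfrak m=\sum_{\mathfrak p}n_{\mathfrak p}(\mathfrak m)\,\mathfrak p$ for $\mathfrak m\in\mathcal M$, and extend the norm by $N(\mathfrak m)=\prod_{\mathfrak p}N(\mathfrak p)^{n_{\mathfrak p}(\mathfrak m)}$. Let $X$ be a set that contains $N(\mathcal M)$, where $X=\mathbb Q$ or $X=\{q^z:z\in\mathbb Z\}$ for some integer $q\ge 2$. Assume that for some $\kappa>0$ and $0\le\theta<1$ $$|\{\mathfrak m\in\mathcal M: N(\mathfrak m)\le x\}|=\kappa x+O(x^\theta)\qquad(x\in X,\ x\to\infty).$$ For $i\ge1$ let $\omega_i(\mathfrak m)$ be the number of $\mathfrak p\in\mathcal P$ with $n_{\mathfrak p}(\mathfrak m)=i$. Let $\mathcal A=(a_1,a_2,\dots)$ be a sequence of complex numbers and $\omega_{\mathcal A}(\mathfrak m)=\sum_{i\ge1}a_i\,\omega_i(\mathfrak m)$ (a finite sum). Let $k\ge1$ be an integer with $a_k\ne0$, and assume that $a_i\ll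 B^i$ as $i\to\infty$, where $0<B\le 2^{\frac1k-\alpha}$ for some $\alpha>0$. Let $\mathcal N_k(x)$ be the set of the $k$-full elements of norm at most $x$, that is, of the $\mathfrak m\in\mathcal M$ with $N(\mathfrak m)\le x$ such that each $n_{\mathfrak p}(\mathfrak m)$ is $0$ or at least $k$. For $N(\mathfrak m)\ge3$ put $$G(\mathfrak m)=\frac{\frac1{a_k}\omega_{\mathcal A}(\mathfrak m)-\log\log N(\mathfrak m)}{\sqrt{\log\log N(\mathfrak m)}}\in\mathbb C.$$ Then, as $x\to\infty$ in $X$, $G$ has a standard real Gaussian limit distribution on $\mathcal N_k(x)$: for every $t\in\mathbb R$ $$\lim_{x\to\infty}\frac{1}{|\mathcal N_k(x)|}\left|\left\{\mathfrak m\in\mathcal N_k(x): N(\mathfrak m)\ge3,\ \operatorname{Re}G(\mathfrak m)\le t\right\}\right|=\frac1{\sqrt{2\pi}}\int_{-\infty}^t e^{-u^2/2}\,du,$$ and for every $\varepsilon>0$ $$\lim_{x\to\infty}\frac{1}{|\mathcal N_k(x)|}\left|\left\{\mathfrak m\in\mathcal N_k(x): N(\mathfrak m)\ge3,\ |\operatorname{Im}G(\mathfrak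 m)|>\varepsilon\right\}\right|=0.$$ In particular, if all $a_i/a_k$ are real, then $G$ is real and the first limit holds with $G(\mathfrak m)\le t$. -/

import Mathlib

open Filter Topology Asymptotics

noncomputable section

namespace ErdosKac

/-- The free abelian monoid generated by a set `P` of prime elements, written additively:
`m` corresponds to the formal sum of the `m p • p`, so `m p` is the multiplicity of `p`. -/
abbrev FreeMon (P : Type*) := P →₀ ℕ

/-- The extension to the free abelian monoid of a norm map given on the prime elements. -/
def normM {P : Type*} (N : P → ℕ) (m : FreeMon P) : ℕ :=
  m.prod fun p n => N p ^ n

/-- The admissible sets `X` of values of the variable `x`: the set contains all the norms, and it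
is either the set of all rational numbers or the set of integral powers of an integer `q ≥ 2`. -/
def IsRange {P : Type*} (N : P → ℕ) (X : Set ℚ) : Prop :=
  (∀ m : FreeMon P, (normM N m : ℚ) ∈ X) ∧
    (X = Set.univ ∨ ∃ q : ℕ, 2 ≤ q ∧ X = {x : ℚ | ∃ z : ℤ, x = (q : ℚ) ^ z})

/-- The filter of the limits `x → ∞` with `x` restricted to `X`. -/
def toInfinity (X : Set ℚ) : Filter ℚ := atTop ⊓ 𝓟 X

/-- The elements of a set `S` of norm at most `x`. -/
def upTo {P : Type*} (N : P → ℕ) (S : Set (FreeMon P)) (x : ℚ) : Set (FreeMon P) :=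
  {m | m ∈ S ∧ (normM N m : ℚ) ≤ x}

/-- The number of elements of norm at most `x` is `κ x + O(x ^ θ)` for large `x` in `X`, for some
`κ > 0` and `0 ≤ θ < 1`. (As `κ > 0` and `Set.ncard` vanishes on infinite sets, this
forces the number of elements of norm at most `x` to be finite for every `x`.) -/
def LinearGrowth {P : Type*} (N : P → ℕ) (X : Set ℚ) : Prop :=
  ∃ κ θ : ℝ, 0 < κ ∧ 0 ≤ θ ∧ θ < 1 ∧
    (fun x : ℚ => ((upTo N Set.univ x).ncard : ℝ) - κ * (x : ℝ))
      =O[toInfinity X] fun x : ℚ => (x : ℝ) ^ θ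

/-- The `k`-full elements: every prime element that occurs does so with multiplicity at
least `k`. For `k = 1` these are all the elements. -/
def full (P : Type*) (k : ℕ) : Set (FreeMon P) :=
  {m | ∀ p ∈ m.support, k ≤ m p}

/-- `ω_i(m)` for `i ≥ 1`, the number of prime elements of multiplicity exactly `i` in `m`. -/
def omega {P : Type*} (i : ℕ) (m : FreeMon P) : ℕ :=
  (m.support.filter fun p => m p = i).card

/-- `ω_𝒜(m) = ∑_{i ≥ 1} a_i ω_i(m)`, with finitely many nonzero terms. The value `a 0` is
not used. -/
def omegaSeq {P : Type*} (a : ℕ → ℂ) (m : FreeMon P) : ℂ :=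
  ∑ᶠ (i : ℕ) (_ : 1 ≤ i), a i * (omega i m : ℂ)

/-- Only finitely many `ω_i(m)` are nonzero. -/
theorem omega_support_finite {P : Type*} (m : FreeMon P) :
    (Function.support fun i : ℕ => omega i m).Finite := by
  refine (m.support.image m).finite_toSet.subset fun i hi => ?_
  obtain ⟨p, hp⟩ := Finset.card_pos.1 (Nat.pos_of_ne_zero hi)
  rw [Finset.mem_filter] at hp
  exact Finset.mem_coe.2 (Finset.mem_image.2 ⟨p, hp.1, hp.2⟩)

/-- The normalization `(g(m) - log log N(m)) / √(log log N(m))` of `g = (1 / a_k) ω_𝒜`. -/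
def normalized {P : Type*} (N : P → ℕ) (a : ℕ → ℂ) (k : ℕ) (m : FreeMon P) : ℂ :=
  (1 / a k * omegaSeq a m - (Real.log (Real.log (normM N m)) : ℂ)) /
    (√(Real.log (Real.log (normM N m))) : ℂ)

/-- The proportion, among the elements of `S` of norm at most `x`, of those of norm at
least `3` with the property `Q`. -/
def proportion {P : Type*} (N : P → ℕ) (S : Set (FreeMon P)) (Q : FreeMon P → Prop) (x : ℚ) : ℝ :=
  ({m | m ∈ upTo N S x ∧ 3 ≤ normM N m ∧ Q m}.ncard : ℝ) / ((upTo N S x).ncard : ℝ)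

/-- The standard Gaussian distribution function. -/
def Phi (t : ℝ) : ℝ :=
  1 / √(2 * Real.pi) * ∫ u in Set.Iic t, Real.exp (-u ^ 2 / 2)

end ErdosKac

end

noncomputable section

namespace ErdosKac

/-! Write L = log log x. The hypothesis gives, for all real y ≥ 1, a count κ g(y) + O(y^θ) of the
elements of norm at most y. Here g(y) = y if `X` is all of ℚ, and g(y) is the largest power of q not
exceeding y otherwise. `RegularNorm` records this, and every limit is then proved along real x.

For the whole monoid this is the theorem of Erdős and Kac. The prime p occurs with density about
1/N(p), different small primes are nearly independent, and ∑_{N(p) ≤ x} 1/N(p) = L + o(√L) by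
`exists_abs_invSum_sub_le`. Only primes up to w = x^(1/L²) are kept. For |z| = 1 the mean of z^ω
over these primes is found by truncated inclusion-exclusion in `norm_sum_pow_omegaLe_sub_le`. For z
= exp(iξ/√L) the resulting product is exp(iξ√L - ξ²/2 + o(1)), by `tendsto_prod_incr`.

A k-full m is uniquely k a + b, where the multiplicities in b vanish or lie strictly between k and
2k. Since ∑ N(b)^(-1/k) converges, dominated convergence over b carries the limit from a to m
(`tendsto_sum_fullBall_character`), and Lévy's continuity theorem gives a Gaussian law for the
truncated ω(a).

Finally ω_𝒜/a_k differs from the truncated ω(a) by o(√L) on average (`tendsto_sum_norm_deviation`).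
Primes of multiplicity k above w contribute O(∑_{w < N(p) ≤ x} 1/N(p)) = o(√L). Multiplicities l > k
contribute O(∑ β^l N(p)^(-l/k)), which converges because β < 2^(1/k). Markov's inequality makes the
difference negligible in probability. Elements of norm at most √x are negligible too, and for the
others log log N(m) is within 1 of L. -/

variable {P : Type*} {N : P → ℕ}

/-! ### Arithmetic of the norm -/

theorem normM_zero (N : P → ℕ) : normM N 0 = 1 := by simp [normM]

theorem normM_add (N : P → ℕ) (m n : FreeMon P) : normM N (m + n) = normM N m * normM N n := by
  classical
  exact Finsupp.prod_add_index' (fun p => pow_zero _) fun p i j => pow_add _ i j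

theorem normM_single (N : P → ℕ) (p : P) (n : ℕ) : normM N (Finsupp.single p n) = N p ^ n := by
  simp [normM]

theorem normM_nsmul (N : P → ℕ) (n : ℕ) (m : FreeMon P) : normM N (n • m) = normM N m ^ n := by
  induction n with
  | zero => simp [normM_zero]
  | succ n ih => rw [succ_nsmul, normM_add, ih, pow_succ]

theorem normM_pos (hN : ∀ p, 1 < N p) (m : FreeMon P) : 0 < normM N m :=
  Finset.prod_pos fun p _ => pow_pos (by have := hN p; omega) _

theorem normM_mono (hN : ∀ p, 1 < N p) {m n : FreeMon P} (h : m ≤ n) : normM N m ≤ normM N n := by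
  rw [← add_tsub_cancel_of_le h, normM_add]
  exact Nat.le_mul_of_pos_right _ (normM_pos hN _)

theorem le_normM (hN : ∀ p, 1 < N p) (m : FreeMon P) (p : P) :
    N p ^ m p ≤ normM N m := by
  rw [← normM_single]
  exact normM_mono hN (Finsupp.single_le_iff.2 le_rfl)

theorem normM_rpow (N : P → ℕ) (m : FreeMon P) (s : ℝ) :
    (normM N m : ℝ) ^ s = ∏ p ∈ m.support, (N p : ℝ) ^ ((m p : ℝ) * s) := by
  rw [normM, Finsupp.prod, Nat.cast_prod, ← Real.finsetProd_rpow _ _ fun p _ => by positivity]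
  refine Finset.prod_congr rfl fun p _ => ?_
  rw [Nat.cast_pow, ← Real.rpow_natCast, ← Real.rpow_mul (by positivity)]

/-! ### Regular norms and linear bounds for the counting function -/

/-- A norm whose counting function is `κ g(y) + O(y ^ θ)` with a comparison function `g` of
the order of magnitude of `y`, compatible with division by norms. -/
structure RegularNorm (N : P → ℕ) where
  one_lt : ∀ p, 1 < N p
  fin : ∀ y : ℝ, {m : FreeMon P | (normM N m : ℝ) ≤ y}.Finite
  (κ C θ Q : ℝ)
  g : ℝ → ℝ
  κ_pos : 0 < κ
  C_nonneg : 0 ≤ C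
  θ_nonneg : 0 ≤ θ
  θ_lt_one : θ < 1
  Q_pos : 0 < Q
  -- Homogeneity is asked for division by norms only: the largest power of q below y does not scale
  -- under arbitrary real factors.
  g_div : ∀ (m : FreeMon P) (y : ℝ), 0 < y → g (y / normM N m) = g y / normM N m
  g_le : ∀ y, 1 ≤ y → g y ≤ y
  le_g : ∀ y, 1 ≤ y → y ≤ Q * g y
  count : ∀ y, 1 ≤ y → |((fin y).toFinset.card : ℝ) - κ * g y| ≤ C * y ^ θ

namespace RegularNorm

/-- The finite set of the elements of norm at most `y`. -/
def ball (D : RegularNorm N) (y : ℝ) : Finset (FreeMon P) := (D.fin y).toFinset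

variable (D : RegularNorm N)

theorem mem_ball {y : ℝ} {m : FreeMon P} : m ∈ D.ball y ↔ (normM N m : ℝ) ≤ y := by
  simp [ball]

theorem one_le_norm (D : RegularNorm N) (m : FreeMon P) : (1 : ℝ) ≤ normM N m := by
  exact_mod_cast normM_pos D.one_lt m

theorem two_le (D : RegularNorm N) (p : P) : (2 : ℝ) ≤ N p := by exact_mod_cast D.one_lt p

theorem ball_eq_empty {y : ℝ} (hy : y < 1) : D.ball y = ∅ := by
  refine Finset.eq_empty_of_forall_notMem fun m hm => ?_
  have := D.mem_ball.1 hm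
  have := D.one_le_norm m
  linarith

theorem card_ball {y : ℝ} (hy : 1 ≤ y) : |((D.ball y).card : ℝ) - D.κ * D.g y| ≤ D.C * y ^ D.θ :=
  D.count y hy

theorem g_pos {y : ℝ} (hy : 1 ≤ y) : 0 < D.g y := by
  have := D.le_g y hy
  by_contra! h
  nlinarith [D.Q_pos]

theorem rpow_theta_le {y : ℝ} (hy : 1 ≤ y) : y ^ D.θ ≤ y := by
  calc y ^ D.θ ≤ y ^ (1 : ℝ) := Real.rpow_le_rpow_of_exponent_le hy D.θ_lt_one.le
    _ = y := Real.rpow_one y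

/-- The constant of the linear upper bound for the counting function. -/
def K : ℝ := D.κ + D.C

theorem K_pos : 0 < D.K := add_pos_of_pos_of_nonneg D.κ_pos D.C_nonneg

theorem card_ball_le {y : ℝ} (hy : 0 ≤ y) : ((D.ball y).card : ℝ) ≤ D.K * y := by
  rcases lt_or_ge y 1 with h | h
  · rw [D.ball_eq_empty h]
    simpa using mul_nonneg D.K_pos.le hy
  · have h1 := (abs_le.1 (D.card_ball h)).2
    have h2 := mul_le_mul_of_nonneg_left (D.rpow_theta_le h) D.C_nonneg
    have h3 := mul_le_mul_of_nonneg_left (D.g_le y h) D.κ_pos.le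
    rw [K]
    linarith

/-- For large y the main term dominates the error; on the remaining bounded range the zero element
alone gives a positive count. -/
theorem exists_le_card_ball : ∃ c : ℝ, 0 < c ∧ ∀ y, 1 ≤ y → c * y ≤ ((D.ball y).card : ℝ) := by
  have hκ := D.κ_pos
  have hQ := D.Q_pos
  have hlim : Tendsto (fun y : ℝ => D.C * y ^ (-(1 - D.θ))) atTop (𝓝 0) := by
    simpa using (tendsto_rpow_neg_atTop (sub_pos.2 D.θ_lt_one)).const_mul D.C
  have hev : ∀ᶠ y : ℝ in atTop, D.C * y ^ (-(1 - D.θ)) < D.κ / (2 * D.Q) :=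
    hlim.eventually_lt_const (by positivity)
  obtain ⟨y₁, hy₁⟩ := (hev.and (eventually_ge_atTop 1)).exists_forall_of_atTop
  have hy₁1 : 1 ≤ y₁ := (hy₁ y₁ le_rfl).2
  refine ⟨min (D.κ / (2 * D.Q)) y₁⁻¹, lt_min (by positivity) (by positivity), fun y hy => ?_⟩
  rcases le_total y₁ y with h | h
  · have h1 := (hy₁ y h).1.le
    have h2 := (abs_le.1 (D.card_ball hy)).1
    have h3 : D.C * y ^ D.θ ≤ D.κ / (2 * D.Q) * y := by
      have : y ^ D.θ = y ^ (-(1 - D.θ)) * y := by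
        rw [← Real.rpow_add_one (by positivity)]
        ring_nf
      rw [this, ← mul_assoc]
      gcongr
    have h4 : D.κ / D.Q * y ≤ D.κ * D.g y := by
      rw [div_mul_eq_mul_div, div_le_iff₀ hQ]
      nlinarith [D.le_g y hy]
    have h5 : min (D.κ / (2 * D.Q)) y₁⁻¹ * y ≤ D.κ / (2 * D.Q) * y := by
      gcongr
      exact min_le_left _ _
    have h6 : D.κ / D.Q * y = D.κ / (2 * D.Q) * y + D.κ / (2 * D.Q) * y := by
      field_simp
      ring
    linarith
  · have h1 : (1 : ℝ) ≤ (D.ball y).card := by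
      have : 0 < (D.ball y).card := Finset.card_pos.2 ⟨0, D.mem_ball.2 (by simpa [normM_zero])⟩
      exact_mod_cast this
    refine le_trans ?_ h1
    calc min (D.κ / (2 * D.Q)) y₁⁻¹ * y ≤ y₁⁻¹ * y₁ := by
          gcongr
          exact min_le_right _ _
      _ = 1 := inv_mul_cancel₀ (by positivity)

/-- The finite set of the prime elements of norm at most `w`. -/
def primes (w : ℝ) : Finset P :=
  ((D.fin w).preimage (f := fun p : P => Finsupp.single p 1)
    (fun _ _ _ _ h => Finsupp.single_left_injective one_ne_zero h)).toFinset

theorem mem_primes {w : ℝ} {p : P} : p ∈ D.primes w ↔ (N p : ℝ) ≤ w := by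
  simp [primes, normM_single]

/-- The number of prime elements of norm at most `w` in the support. -/
def omegaLe (w : ℝ) (m : FreeMon P) : ℕ := by
  classical exact (D.primes w ∩ m.support).card

/-- The sum of the inverse norms of the prime elements of norm at most `w`. -/
def invSum (w : ℝ) : ℝ := ∑ p ∈ D.primes w, (N p : ℝ)⁻¹

theorem invSum_nonneg (w : ℝ) : 0 ≤ D.invSum w := Finset.sum_nonneg fun _ _ => by positivity

end RegularNorm

/-! ### Euler products over finite boxes, squarefree elements -/

/-- A finite `T` lies in a box of bounded multiplicities over finitely many primes. The sum over the
box factors into terms 1 + ∑ f(p, l), and 1 + u ≤ exp u. Working with finite sets yields convergence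
as well as a bound. -/
theorem sum_prod_le_exp (f : P → ℕ → ℝ) (hf : ∀ p l, 0 ≤ f p l) (H : ℝ)
    (hH : ∀ (F : Finset P) (L : ℕ), ∑ p ∈ F, ∑ l ∈ Finset.Ico 1 L, f p l ≤ H)
    (T : Finset (FreeMon P)) : ∑ m ∈ T, ∏ p ∈ m.support, f p (m p) ≤ Real.exp H := by
  classical
  -- The value 1 at multiplicity 0 lets the product run over a fixed set of primes instead of the
  -- support.
  set f' : P → ℕ → ℝ := fun p l => if l = 0 then 1 else f p l with hf'
  have hf'0 : ∀ p l, 0 ≤ f' p l := fun p l => by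
    by_cases h : l = 0 <;> simp [hf', h, hf p l]
  set S : Finset P := T.biUnion fun m => m.support with hS
  set L : ℕ := T.sup fun m => m.support.sup m with hL
  have hsub : T ⊆ S.finsupp fun _ => Finset.range (L + 1) := by
    intro m hm
    refine Finset.mem_finsupp_iff.2 ⟨Finset.subset_biUnion_of_mem (fun m => m.support) hm,
      fun p _ => Finset.mem_range_succ_iff.2 ?_⟩
    by_cases hp : p ∈ m.support
    · exact (Finset.le_sup (f := m) hp).trans
        (Finset.le_sup (f := fun m : FreeMon P => m.support.sup m) hm)
    · rw [Finsupp.notMem_support_iff.1 hp]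
      exact Nat.zero_le _
  have hterm : ∀ m ∈ S.finsupp fun _ => Finset.range (L + 1),
      ∏ p ∈ m.support, f p (m p) = ∏ p ∈ S, f' p (m p) := by
    intro m hm
    rw [← Finset.prod_subset (Finset.mem_finsupp_iff.1 hm).1]
    · refine Finset.prod_congr rfl fun p hp => ?_
      simp [hf', Finsupp.mem_support_iff.1 hp]
    · intro p _ hp
      simp [hf', Finsupp.notMem_support_iff.1 hp]
  calc ∑ m ∈ T, ∏ p ∈ m.support, f p (m p)
      ≤ ∑ m ∈ S.finsupp fun _ => Finset.range (L + 1), ∏ p ∈ m.support, f p (m p) :=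
        Finset.sum_le_sum_of_subset_of_nonneg hsub fun m _ _ =>
          Finset.prod_nonneg fun p _ => hf p _
    _ = ∑ m ∈ S.finsupp fun _ => Finset.range (L + 1), ∏ p ∈ S, f' p (m p) :=
        Finset.sum_congr rfl hterm
    _ = ∏ p ∈ S, ∑ l ∈ Finset.range (L + 1), f' p l := by
        rw [Finset.prod_sum, Finset.finsupp, Finset.sum_map]
        refine Finset.sum_congr rfl fun h _ => ?_
        rw [← Finset.prod_attach]
        refine Finset.prod_congr rfl fun p _ => ?_
        simp [Finsupp.indicator_apply]
    _ ≤ ∏ p ∈ S, Real.exp (∑ l ∈ Finset.Ico 1 (L + 1), f p l) := by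
        refine Finset.prod_le_prod (fun p _ => Finset.sum_nonneg fun l _ => hf'0 p l) fun p _ => ?_
        rw [Finset.range_eq_Ico, Finset.sum_eq_sum_Ico_succ_bot (Nat.succ_pos L)]
        refine le_trans (le_of_eq ?_) (Real.add_one_le_exp _)
        rw [add_comm]
        congr 1
        refine Finset.sum_congr rfl fun l hl => ?_
        have := (Finset.mem_Ico.1 hl).1
        simp [hf', show l ≠ 0 by omega]
    _ = Real.exp (∑ p ∈ S, ∑ l ∈ Finset.Ico 1 (L + 1), f p l) := (Real.exp_sum _ _).symm
    _ ≤ Real.exp H := Real.exp_le_exp.2 (hH _ _)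

/-- The squarefree element with the given set of prime elements. -/
def sqf (d : Finset P) : FreeMon P := ∑ p ∈ d, Finsupp.single p 1

theorem sqf_apply [DecidableEq P] (d : Finset P) (p : P) : sqf d p = if p ∈ d then 1 else 0 := by
  simp [sqf, Finsupp.finsetSum_apply, Finsupp.single_apply]

theorem sqf_injective : Function.Injective (sqf : Finset P → FreeMon P) := by
  classical
  intro d e h
  ext p
  have := DFunLike.congr_fun h p
  rw [sqf_apply, sqf_apply] at this
  by_cases h1 : p ∈ d <;> by_cases h2 : p ∈ e <;> simp_all

theorem normM_sqf (N : P → ℕ) (d : Finset P) : normM N (sqf d) = ∏ p ∈ d, N p := by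
  classical
  induction d using Finset.induction_on with
  | empty => simp [sqf, normM_zero]
  | insert p d hp ih =>
    rw [Finset.prod_insert hp, ← ih, sqf, Finset.sum_insert hp, normM_add, normM_single, pow_one]
    rfl

theorem sqf_le_iff (d : Finset P) (m : FreeMon P) : sqf d ≤ m ↔ d ⊆ m.support := by
  classical
  constructor
  · intro h p hp
    have := h p
    rw [sqf_apply, if_pos hp] at this
    exact Finsupp.mem_support_iff.2 (by omega)
  · intro h p
    rw [sqf_apply]
    split_ifs with hp
    · exact Nat.one_le_iff_ne_zero.2 (Finsupp.mem_support_iff.1 (h hp))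
    · exact Nat.zero_le _

/-! ### The zeta function of the monoid near 1 -/

-- Partial summation in integral form. Values in [0, ∞] let the sum over the monoid and the integral
-- be interchanged before summability is known.
open MeasureTheory Set in
theorem ofReal_rpow_eq_lintegral {a δ : ℝ} (ha : 1 ≤ a) (hδ : 0 < δ) :
    ENNReal.ofReal (a ^ (-(1 + δ))) = ∫⁻ x in Ici (1 : ℝ),
      (Ici a).indicator (fun x => ENNReal.ofReal ((1 + δ) * x ^ (-(2 + δ)))) x := by
  have ha0 : 0 < a := by linarith
  rw [lintegral_indicator measurableSet_Ici, Measure.restrict_restrict measurableSet_Ici,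
    inter_eq_self_of_subset_left (Ici_subset_Ici.2 ha), Measure.restrict_congr_set Ioi_ae_eq_Ici.symm,
    ← ofReal_integral_eq_lintegral_ofReal]
  · rw [integral_const_mul, integral_Ioi_rpow_of_lt (by linarith) ha0]
    congr 1
    have : -(2 + δ) + 1 = -(1 + δ) := by ring
    rw [this]
    field_simp
  · exact (integrableOn_Ioi_rpow_of_lt (by linarith) ha0).const_mul _
  · refine (ae_restrict_iff' measurableSet_Ioi).2 (Eventually.of_forall fun x hx => ?_)
    have : 0 < x := ha0.trans hx
    simp only [Pi.zero_apply]
    positivity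

open MeasureTheory Set in
theorem lintegral_const_mul_rpow {c δ : ℝ} (hc : 0 ≤ c) (hδ : 0 < δ) :
    ∫⁻ x in Ici (1 : ℝ), ENNReal.ofReal (c * x) * ENNReal.ofReal ((1 + δ) * x ^ (-(2 + δ))) =
      ENNReal.ofReal (c * (1 + δ) / δ) := by
  have h1 : ∀ x ∈ Ioi (1 : ℝ), ENNReal.ofReal (c * x) * ENNReal.ofReal ((1 + δ) * x ^ (-(2 + δ))) =
      ENNReal.ofReal (c * (1 + δ) * x ^ (-(1 + δ))) := by
    intro x hx
    have hx0 : (0 : ℝ) < x := zero_lt_one.trans hx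
    rw [← ENNReal.ofReal_mul (by positivity)]
    have : x ^ (-(1 + δ)) = x ^ (-(2 + δ)) * x := by
      rw [← Real.rpow_add_one hx0.ne']
      ring_nf
    rw [this]
    ring_nf
  rw [Measure.restrict_congr_set Ioi_ae_eq_Ici.symm, setLIntegral_congr_fun measurableSet_Ioi h1,
    ← ofReal_integral_eq_lintegral_ofReal]
  · rw [integral_const_mul, integral_Ioi_rpow_of_lt (by linarith) zero_lt_one]
    congr 1
    have : -(1 + δ) + 1 = -δ := by ring
    rw [this, Real.one_rpow]
    field_simp
  · exact (integrableOn_Ioi_rpow_of_lt (by linarith) zero_lt_one).const_mul _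
  · refine (ae_restrict_iff' measurableSet_Ioi).2 (Eventually.of_forall fun x hx => ?_)
    have : (0 : ℝ) < x := zero_lt_one.trans hx
    simp only [Pi.zero_apply]
    positivity

namespace RegularNorm

variable (D : RegularNorm N)

open MeasureTheory Set in
theorem tsum_ofReal_eq_lintegral [Countable P] {δ : ℝ} (hδ : 0 < δ) :
    ∑' m : FreeMon P, ENNReal.ofReal ((normM N m : ℝ) ^ (-(1 + δ))) =
      ∫⁻ x in Ici (1 : ℝ), ((D.ball x).card : ENNReal) *
        ENNReal.ofReal ((1 + δ) * x ^ (-(2 + δ))) := by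
  have h1 : ∀ m : FreeMon P, ENNReal.ofReal ((normM N m : ℝ) ^ (-(1 + δ))) = _ := fun m =>
    ofReal_rpow_eq_lintegral (D.one_le_norm m) hδ
  simp_rw [h1]
  rw [← lintegral_tsum]
  · refine lintegral_congr fun x => ?_
    rw [tsum_eq_sum (s := D.ball x)]
    · rw [← nsmul_eq_mul, ← Finset.sum_const]
      refine Finset.sum_congr rfl fun m hm => ?_
      rw [indicator_of_mem]
      exact D.mem_ball.1 hm
    · intro m hm
      rw [indicator_of_notMem]
      exact fun h => hm (D.mem_ball.2 h)
  · intro m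
    refine (Measurable.indicator ?_ measurableSet_Ici).aemeasurable
    fun_prop

theorem tsum_ofReal_le (D : RegularNorm N) [Countable P] {δ : ℝ} (hδ : 0 < δ) :
    ∑' m : FreeMon P, ENNReal.ofReal ((normM N m : ℝ) ^ (-(1 + δ))) ≤
      ENNReal.ofReal (D.K * (1 + δ) / δ) := by
  rw [D.tsum_ofReal_eq_lintegral hδ, ← lintegral_const_mul_rpow D.K_pos.le hδ]
  refine MeasureTheory.setLIntegral_mono' measurableSet_Ici fun x hx => ?_
  gcongr
  rw [← ENNReal.ofReal_natCast]
  exact ENNReal.ofReal_le_ofReal (D.card_ball_le (zero_le_one.trans hx))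

theorem summable_norm (D : RegularNorm N) [Countable P] {δ : ℝ} (hδ : 0 < δ) :
    Summable fun m : FreeMon P => (normM N m : ℝ) ^ (-(1 + δ)) := by
  have h := (D.tsum_ofReal_le hδ).trans_lt ENNReal.ofReal_lt_top
  have h2 := ENNReal.summable_toReal h.ne
  refine h2.congr fun m => ?_
  rw [ENNReal.toReal_ofReal (by positivity)]

theorem tsum_norm_le (D : RegularNorm N) [Countable P] {δ : ℝ} (hδ : 0 < δ) :
    ∑' m : FreeMon P, (normM N m : ℝ) ^ (-(1 + δ)) ≤ D.K * (1 + δ) / δ := by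
  have h := D.tsum_ofReal_le hδ
  rw [← ENNReal.ofReal_tsum_of_nonneg (fun m => by positivity) (D.summable_norm hδ)] at h
  have := D.K_pos
  exact (ENNReal.ofReal_le_ofReal_iff (by positivity)).1 h

theorem exists_le_tsum_norm (D : RegularNorm N) [Countable P] : ∃ c : ℝ, 0 < c ∧ ∀ δ : ℝ, 0 < δ →
    c / δ ≤ ∑' m : FreeMon P, (normM N m : ℝ) ^ (-(1 + δ)) := by
  obtain ⟨c, hc, h⟩ := D.exists_le_card_ball
  refine ⟨c, hc, fun δ hδ => ?_⟩
  have h1 : ENNReal.ofReal (c * (1 + δ) / δ) ≤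
      ∑' m : FreeMon P, ENNReal.ofReal ((normM N m : ℝ) ^ (-(1 + δ))) := by
    rw [D.tsum_ofReal_eq_lintegral hδ, ← lintegral_const_mul_rpow hc.le hδ]
    refine MeasureTheory.setLIntegral_mono' measurableSet_Ici fun x hx => ?_
    gcongr
    rw [← ENNReal.ofReal_natCast]
    exact ENNReal.ofReal_le_ofReal (h x hx)
  rw [← ENNReal.ofReal_tsum_of_nonneg (fun m => by positivity) (D.summable_norm hδ),
    ENNReal.ofReal_le_ofReal_iff (tsum_nonneg fun m => by positivity)] at h1
  refine le_trans ?_ h1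
  gcongr
  nlinarith

/-! ### The prime zeta function and a Mertens estimate -/

/-- The prime zeta function at `1 + δ`. -/
def primeSum (_ : RegularNorm N) (δ : ℝ) : ℝ := ∑' p : P, (N p : ℝ) ^ (-(1 + δ))

theorem summable_prime (D : RegularNorm N) [Countable P] {δ : ℝ} (hδ : 0 < δ) :
    Summable fun p : P => (N p : ℝ) ^ (-(1 + δ)) := by
  refine ((D.summable_norm hδ).comp_injective
    (i := fun p : P => Finsupp.single p 1) (Finsupp.single_left_injective one_ne_zero)).congr
    fun p => ?_
  simp [normM_single]

/-- Second-order terms of the Euler product are thus controlled by `primeSum 1`, uniformly in δ; the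
exponent is left as `-(1 + 1)` to match it. -/
theorem rpow_two_mul_le (D : RegularNorm N) {δ : ℝ} (hδ : 0 ≤ δ) (p : P) :
    ((N p : ℝ) ^ (-(1 + δ))) ^ 2 ≤ (N p : ℝ) ^ (-(1 + 1) : ℝ) := by
  have := D.two_le p
  rw [← Real.rpow_natCast, ← Real.rpow_mul (by positivity)]
  refine Real.rpow_le_rpow_of_exponent_le (by linarith) ?_
  push_cast
  linarith

/-- The squarefree terms of the zeta function already produce every finite product of the 1 +
N(p)^(-1-δ). Take logarithms and use log(1 + u) ≥ u - u². -/
theorem primeSum_le [Countable P] {δ : ℝ} (hδ : 0 < δ) :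
    D.primeSum δ ≤ Real.log (D.K * (1 + δ) / δ) + D.primeSum 1 := by
  classical
  have hK := D.K_pos
  refine (D.summable_prime hδ).tsum_le_of_sum_le fun F => ?_
  have hx : ∀ p : P, 0 < (N p : ℝ) ^ (-(1 + δ)) := fun p => by
    have := D.two_le p
    positivity
  have h1 : ∏ p ∈ F, (1 + (N p : ℝ) ^ (-(1 + δ))) ≤ D.K * (1 + δ) / δ := by
    refine le_trans ?_ (D.tsum_norm_le hδ)
    rw [Finset.prod_one_add]
    have : ∀ d ∈ F.powerset, ∏ p ∈ d, (N p : ℝ) ^ (-(1 + δ)) =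
        (fun m : FreeMon P => (normM N m : ℝ) ^ (-(1 + δ))) (sqf d) := by
      intro d _
      simp only [normM_sqf]
      rw [Nat.cast_prod, Real.finsetProd_rpow _ _ fun p _ => by positivity]
    rw [Finset.sum_congr rfl this,
      ← Finset.sum_image (s := F.powerset) (g := sqf)
        (f := fun m : FreeMon P => (normM N m : ℝ) ^ (-(1 + δ))) fun d _ e _ h => sqf_injective h]
    exact (D.summable_norm hδ).sum_le_tsum _ fun m _ => by positivity
  have h2 : ∑ p ∈ F, Real.log (1 + (N p : ℝ) ^ (-(1 + δ))) ≤ Real.log (D.K * (1 + δ) / δ) := by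
    rw [← Real.log_prod fun p _ => by linarith [hx p]]
    exact Real.log_le_log (Finset.prod_pos fun p _ => by linarith [hx p]) h1
  have h3 : ∑ p ∈ F, (N p : ℝ) ^ (-(1 + 1) : ℝ) ≤ D.primeSum 1 :=
    (D.summable_prime one_pos).sum_le_tsum _ fun m _ => by positivity
  refine le_trans ?_ (add_le_add h2 h3)
  rw [← Finset.sum_add_distrib]
  refine Finset.sum_le_sum fun p _ => ?_
  refine le_trans ?_ (add_le_add le_rfl (D.rpow_two_mul_le hδ.le p))
  set x := (N p : ℝ) ^ (-(1 + δ))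
  have hxp : 0 < x := hx p
  have h4 := Real.one_sub_inv_le_log_of_pos (show 0 < 1 + x by linarith)
  have h5 : 1 - (1 + x)⁻¹ + x ^ 2 - x = x ^ 3 / (1 + x) := by
    field_simp
    ring
  have h6 : 0 ≤ x ^ 3 / (1 + x) := by positivity
  linarith

theorem rpow_le_half (D : RegularNorm N) {δ : ℝ} (hδ : 0 ≤ δ) (p : P) : (N p : ℝ) ^ (-(1 + δ)) ≤ 1 / 2 := by
  have h := D.two_le p
  calc (N p : ℝ) ^ (-(1 + δ)) ≤ (N p : ℝ) ^ (-1 : ℝ) :=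
        Real.rpow_le_rpow_of_exponent_le (by linarith) (by linarith)
    _ = (N p : ℝ)⁻¹ := Real.rpow_neg_one _
    _ ≤ 1 / 2 := by
        rw [one_div]
        exact inv_anti₀ two_pos h

/-- With u = N(p)^(-1-δ) ≤ 1/2, the geometric series satisfies ∑_{l ≥ 1} u^l ≤ u/(1 - u) ≤ u + 2u².
-/
theorem tsum_norm_le_exp [Countable P] {δ : ℝ} (hδ : 0 < δ) :
    ∑' m : FreeMon P, (normM N m : ℝ) ^ (-(1 + δ)) ≤
      Real.exp (D.primeSum δ + 2 * D.primeSum 1) := by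
  refine (D.summable_norm hδ).tsum_le_of_sum_le fun T => ?_
  have h0 : ∀ m ∈ T, (normM N m : ℝ) ^ (-(1 + δ)) =
      ∏ p ∈ m.support, ((N p : ℝ) ^ (-(1 + δ))) ^ m p := by
    intro m _
    rw [normM_rpow]
    refine Finset.prod_congr rfl fun p _ => ?_
    rw [mul_comm, Real.rpow_mul_natCast (by positivity)]
  rw [Finset.sum_congr rfl h0]
  refine sum_prod_le_exp (fun p l => ((N p : ℝ) ^ (-(1 + δ))) ^ l) (fun p l => by positivity) _
    (fun F L => ?_) T
  have h1 : ∀ p ∈ F, ∑ l ∈ Finset.Ico 1 L, ((N p : ℝ) ^ (-(1 + δ))) ^ l ≤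
      (N p : ℝ) ^ (-(1 + δ)) + 2 * (N p : ℝ) ^ (-(1 + 1) : ℝ) := by
    intro p _
    have hx0 : 0 ≤ (N p : ℝ) ^ (-(1 + δ)) := by positivity
    have hx1 := D.rpow_le_half hδ.le p
    have hx2 := D.rpow_two_mul_le hδ.le p
    set x := (N p : ℝ) ^ (-(1 + δ))
    have h2 := geom_sum_Ico_le_of_lt_one (m := 1) (n := L) hx0 (by linarith)
    refine h2.trans ?_
    rw [div_le_iff₀ (by linarith)]
    nlinarith
  refine (Finset.sum_le_sum h1).trans ?_
  rw [Finset.sum_add_distrib, ← Finset.mul_sum]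
  gcongr
  · exact (D.summable_prime hδ).sum_le_tsum _ fun m _ => by positivity
  · exact (D.summable_prime one_pos).sum_le_tsum _ fun m _ => by positivity

theorem exists_abs_primeSum_add_log_le [Countable P] :
    ∃ C₀ : ℝ, 0 ≤ C₀ ∧ ∀ δ : ℝ, 0 < δ → δ ≤ 1 → |D.primeSum δ + Real.log δ| ≤ C₀ := by
  obtain ⟨c, hc, h⟩ := D.exists_le_tsum_norm
  have hK := D.K_pos
  have hP : 0 ≤ D.primeSum 1 := tsum_nonneg fun p => by positivity
  refine ⟨|Real.log (2 * D.K)| + |Real.log c| + 2 * D.primeSum 1, by positivity,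
    fun δ hδ hδ1 => abs_le.2 ⟨?_, ?_⟩⟩
  · have h1 := Real.log_le_log (by positivity) ((h δ hδ).trans (D.tsum_norm_le_exp hδ))
    rw [Real.log_exp, Real.log_div hc.ne' hδ.ne'] at h1
    have := neg_abs_le (Real.log c)
    have := abs_nonneg (Real.log (2 * D.K))
    linarith
  · have h1 := D.primeSum_le hδ
    have h2 : Real.log (D.K * (1 + δ) / δ) ≤ Real.log (2 * D.K / δ) := by
      refine Real.log_le_log (by positivity) ?_
      rw [mul_comm 2]
      gcongr
      linarith
    rw [Real.log_div (x := 2 * D.K) (by positivity) hδ.ne'] at h2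
    have := le_abs_self (Real.log (2 * D.K))
    have := abs_nonneg (Real.log c)
    linarith

/-- Rankin's trick: (x/N(p))^δ ≥ 1 for every prime that is counted. -/
theorem invSum_le [Countable P] {x δ : ℝ} (hx : 0 ≤ x) (hδ : 0 < δ) :
    D.invSum x ≤ x ^ δ * D.primeSum δ := by
  have h1 : D.invSum x ≤ ∑ p ∈ D.primes x, x ^ δ * (N p : ℝ) ^ (-(1 + δ)) := by
    refine Finset.sum_le_sum fun p hp => ?_
    have hp2 := D.two_le p
    have hpx := D.mem_primes.1 hp
    calc (N p : ℝ)⁻¹ = (N p : ℝ) ^ δ * (N p : ℝ) ^ (-(1 + δ)) := by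
          rw [← Real.rpow_add (by positivity), ← Real.rpow_neg_one]
          ring_nf
      _ ≤ _ := by gcongr
  refine h1.trans ?_
  rw [← Finset.mul_sum]
  gcongr
  exact (D.summable_prime hδ).sum_le_tsum _ fun m _ => by positivity

/-- For primes beyond x, half of the excess δ is spent on the factor x^(-δ/2), and the other half
keeps the tail convergent. -/
theorem primeSum_le_invSum [Countable P] {x δ : ℝ} (hx : 0 < x) (hδ : 0 < δ) :
    D.primeSum δ ≤ D.invSum x + x ^ (-(δ / 2)) * D.primeSum (δ / 2) := by
  classical
  have hs : Summable fun p : P => if p ∈ D.primes x then (N p : ℝ)⁻¹ else 0 :=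
    summable_of_ne_finset_zero (s := D.primes x) fun p hp => if_neg hp
  have hs2 := (D.summable_prime (half_pos hδ)).mul_left (x ^ (-(δ / 2)))
  have h1 : D.invSum x = ∑' p : P, if p ∈ D.primes x then (N p : ℝ)⁻¹ else 0 := by
    rw [tsum_eq_sum (s := D.primes x) fun p hp => if_neg hp, invSum]
    exact Finset.sum_congr rfl fun p hp => (if_pos hp).symm
  rw [h1, primeSum, primeSum, ← tsum_mul_left, ← hs.tsum_add hs2]
  refine (D.summable_prime hδ).tsum_le_tsum (fun p => ?_) (hs.add hs2)
  have hp2 := D.two_le p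
  split_ifs with hp
  · have h2 : (N p : ℝ) ^ (-(1 + δ)) ≤ (N p : ℝ)⁻¹ := by
      rw [← Real.rpow_neg_one]
      exact Real.rpow_le_rpow_of_exponent_le (by linarith) (by linarith)
    have h3 : 0 ≤ x ^ (-(δ / 2)) * (N p : ℝ) ^ (-(1 + δ / 2)) := by positivity
    linarith
  · rw [D.mem_primes, not_le] at hp
    rw [zero_add]
    calc (N p : ℝ) ^ (-(1 + δ)) = (N p : ℝ) ^ (-(δ / 2)) * (N p : ℝ) ^ (-(1 + δ / 2)) := by
          rw [← Real.rpow_add (by linarith)]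
          ring_nf
      _ ≤ _ := by
          gcongr ?_ * _
          exact Real.rpow_le_rpow_of_nonpos hx hp.le (by linarith)

/-- A weak form of the second theorem of Mertens. -/
theorem exists_abs_invSum_sub_le [Countable P] : ∃ C₁ : ℝ, ∀ᶠ x : ℝ in atTop,
    |D.invSum x - Real.log (Real.log x)| ≤ C₁ + Real.log (Real.log (Real.log x)) := by
  obtain ⟨C₀, hC₀, h⟩ := D.exists_abs_primeSum_add_log_le
  refine ⟨3 * C₀ + 4, ?_⟩
  have hlog := Real.tendsto_log_atTop
  filter_upwards [(hlog.comp hlog).eventually_ge_atTop 1, hlog.eventually_ge_atTop 1,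
    eventually_gt_atTop 0] with x hL hX hx0
  simp only [Function.comp_apply] at hL
  set X := Real.log x with hXdef
  set L := Real.log X with hLdef
  have hLX : L ≤ X := (Real.log_le_sub_one_of_pos (by linarith)).trans (by linarith)
  have hlL : Real.log L ≤ L := (Real.log_le_sub_one_of_pos (by linarith)).trans (by linarith)
  have hlL0 : 0 ≤ Real.log L := Real.log_nonneg hL
  have hX0 : 0 < X := by linarith
  have hL0 : 0 < L := by linarith
  refine abs_le.2 ⟨?_, ?_⟩
  -- With δ = L/X the tail factor x^(-δ/2) is exp(-L/2), which absorbs the size O(L) of the prime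
  -- zeta function, while log(1/δ) loses only log L against L.
  · have hδ0 : 0 < L / X := by positivity
    have hδ1 : L / X ≤ 1 := (div_le_one hX0).2 hLX
    have h1 := (abs_le.1 (h _ hδ0 hδ1)).1
    have h2 := (abs_le.1 (h _ (half_pos hδ0) (by linarith))).2
    have h3 := D.primeSum_le_invSum hx0 hδ0
    rw [Real.log_div hδ0.ne' two_ne_zero,
      Real.log_div hL0.ne' hX0.ne'] at h2
    rw [Real.log_div hL0.ne' hX0.ne'] at h1
    have h4 : x ^ (-(L / X / 2)) = Real.exp (-(L / 2)) := by
      rw [Real.rpow_def_of_pos hx0, ← hXdef]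
      congr 1
      field_simp
    rw [h4] at h3
    have hlog2 : Real.log 2 ≤ 1 := by
      have := Real.log_two_lt_d9
      linarith
    have h5 : D.primeSum (L / X / 2) ≤ C₀ + 1 + L := by linarith
    have h6 : Real.exp (-(L / 2)) * L ≤ 2 := by
      have := Real.add_one_le_exp (L / 2)
      rw [Real.exp_neg, inv_mul_le_iff₀ (Real.exp_pos _)]
      linarith
    have h7 : Real.exp (-(L / 2)) ≤ 1 := Real.exp_le_one_iff.2 (by linarith)
    have h8 : Real.exp (-(L / 2)) * D.primeSum (L / X / 2) ≤ C₀ + 1 + 2 := by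
      calc Real.exp (-(L / 2)) * D.primeSum (L / X / 2)
          ≤ Real.exp (-(L / 2)) * (C₀ + 1 + L) := by gcongr
        _ = Real.exp (-(L / 2)) * (C₀ + 1) + Real.exp (-(L / 2)) * L := by ring
        _ ≤ 1 * (C₀ + 1) + 2 := by gcongr
        _ = _ := by ring
    linarith
  -- With δ = 1/(X L) the factor x^δ is 1 + O(1/L), so multiplying by it costs O(1), while log(1/δ)
  -- exceeds L only by log L.
  · have hδ0 : 0 < 1 / (X * L) := by positivity
    have hδ1 : 1 / (X * L) ≤ 1 := by
      rw [div_le_one (by positivity)]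
      nlinarith
    have h1 := (abs_le.1 (h _ hδ0 hδ1)).2
    have h2 := D.invSum_le hx0.le hδ0
    rw [one_div, Real.log_inv, Real.log_mul hX0.ne' hL0.ne', ← one_div] at h1
    have h4 : x ^ (1 / (X * L)) = Real.exp (1 / L) := by
      rw [Real.rpow_def_of_pos hx0, ← hXdef]
      congr 1
      field_simp
    rw [h4] at h2
    have h5 : D.primeSum (1 / (X * L)) ≤ C₀ + L + Real.log L := by linarith
    have h6 : Real.exp (1 / L) ≤ 1 + 2 / L := by
      have hu : 1 / L ≤ 1 := (div_le_one hL0).2 hL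
      have hu0 : 0 < 1 / L := by positivity
      have := (abs_le.1 (Real.abs_exp_sub_one_sub_id_le (x := 1 / L) (by rwa [abs_of_pos hu0]))).2
      have h8 : 2 / L = 1 / L + 1 / L := by ring
      nlinarith
    have h7 : Real.exp (1 / L) * D.primeSum (1 / (X * L)) ≤
        (1 + 2 / L) * (C₀ + L + Real.log L) := by
      have : 0 ≤ D.primeSum (1 / (X * L)) := tsum_nonneg fun p => by positivity
      gcongr
    have h8 : (1 + 2 / L) * (C₀ + L + Real.log L) =
        (C₀ + L + Real.log L) + (2 * (C₀ / L) + 2 + 2 * (Real.log L / L)) := by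
      field_simp
    have h9 : C₀ / L ≤ C₀ := div_le_self hC₀ hL
    have h10 : Real.log L / L ≤ 1 := (div_le_one hL0).2 hlL
    linarith

end RegularNorm

/-! ### Truncated inclusion-exclusion -/

/-- A complex form of the Bonferroni inequalities. By Pascal's rule the remainders satisfy E(n+1,
R+1) = E(n, R+1) + ζ E(n, R), and the bounds obey the same recursion. The condition on 1 + ζ serves
the case R = 0. -/
theorem norm_pow_sub_sum_choose_le {ζ : ℂ} (h : ‖1 + ζ‖ ≤ 1) (R n : ℕ) :
    ‖(1 + ζ) ^ n - ∑ j ∈ Finset.range R, (n.choose j : ℂ) * ζ ^ j‖ ≤ n.choose R * ‖ζ‖ ^ R := by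
  induction n generalizing R with
  | zero =>
    cases R with
    | zero => simp
    | succ R => simp [Finset.sum_range_succ']
  | succ n ih =>
    cases R with
    | zero => simpa using pow_le_one₀ (norm_nonneg _) h
    | succ R =>
      have h1 : (1 + ζ) ^ (n + 1) -
          ∑ j ∈ Finset.range (R + 1), ((n + 1).choose j : ℂ) * ζ ^ j =
          ((1 + ζ) ^ n - ∑ j ∈ Finset.range (R + 1), (n.choose j : ℂ) * ζ ^ j) +
          ζ * ((1 + ζ) ^ n - ∑ j ∈ Finset.range R, (n.choose j : ℂ) * ζ ^ j) := by
        rw [Finset.sum_range_succ', Finset.sum_range_succ' _ R, mul_sub, Finset.mul_sum]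
        have : ∑ j ∈ Finset.range R, ((n + 1).choose (j + 1) : ℂ) * ζ ^ (j + 1) =
            ∑ j ∈ Finset.range R, ζ * ((n.choose j : ℂ) * ζ ^ j) +
            ∑ j ∈ Finset.range R, (n.choose (j + 1) : ℂ) * ζ ^ (j + 1) := by
          rw [← Finset.sum_add_distrib]
          refine Finset.sum_congr rfl fun j _ => ?_
          rw [Nat.choose_succ_succ]
          push_cast
          ring
        rw [this]
        simp only [Nat.choose_zero_right, Nat.cast_one, pow_zero]
        ring
      rw [h1]
      refine (norm_add_le _ _).trans ?_
      rw [norm_mul]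
      refine (add_le_add (ih (R + 1)) (mul_le_mul_of_nonneg_left (ih R) (norm_nonneg _))).trans ?_
      rw [Nat.choose_succ_succ]
      push_cast
      apply le_of_eq
      ring

theorem norm_pow_card_sub_sum_le {ζ : ℂ} (h : ‖1 + ζ‖ ≤ 1) (R : ℕ) (s : Finset P) :
    ‖(1 + ζ) ^ s.card - ∑ d ∈ s.powerset with d.card < R, ζ ^ d.card‖ ≤
      s.card.choose R * ‖ζ‖ ^ R := by
  have h1 : ∑ d ∈ s.powerset with d.card < R, ζ ^ d.card =
      ∑ j ∈ Finset.range R, (s.card.choose j : ℂ) * ζ ^ j := by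
    rw [Finset.sum_filter, Finset.sum_powerset_apply_card fun j => if j < R then ζ ^ j else 0]
    simp only [nsmul_eq_mul, mul_ite, mul_zero]
    rw [← Finset.sum_filter]
    have h2 : (Finset.range (s.card + 1)).filter (· < R) ⊆ Finset.range R := fun j hj =>
      Finset.mem_range.2 (Finset.mem_filter.1 hj).2
    refine Finset.sum_subset h2 fun j hj hj' => ?_
    have : s.card < j := by
      by_contra! hle
      exact hj' (Finset.mem_filter.2 ⟨Finset.mem_range.2 (by omega), Finset.mem_range.1 hj⟩)
    rw [Nat.choose_eq_zero_of_lt this]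
    simp
  rw [h1]
  exact norm_pow_sub_sum_choose_le h R _

theorem sum_powerset_pow_card_le (T : Finset P) (v : P → ℝ) (hv : ∀ p, 0 ≤ v p) {t : ℝ}
    (ht : 0 ≤ t) :
    ∑ d ∈ T.powerset, t ^ d.card * ∏ p ∈ d, v p ≤ Real.exp (t * ∑ p ∈ T, v p) := by
  classical
  have h1 : ∑ d ∈ T.powerset, t ^ d.card * ∏ p ∈ d, v p = ∏ p ∈ T, (1 + t * v p) := by
    rw [Finset.prod_one_add]
    refine Finset.sum_congr rfl fun d _ => ?_
    rw [Finset.prod_mul_distrib, Finset.prod_const]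
  rw [h1, Finset.mul_sum, Real.exp_sum]
  refine Finset.prod_le_prod (fun p _ => ?_) fun p _ => ?_
  · have := mul_nonneg ht (hv p)
    linarith
  · rw [add_comm]
    exact Real.add_one_le_exp _

/-- Rankin's trick in the number of primes: insert the factor e^(|d| - R) ≥ 1 and complete the sum
to all subsets. -/
theorem sum_powerset_le_of_le_card (T : Finset P) (v : P → ℝ) (hv : ∀ p, 0 ≤ v p) {t : ℝ}
    (ht : 0 ≤ t) (R : ℕ) :
    ∑ d ∈ T.powerset with R ≤ d.card, t ^ d.card * ∏ p ∈ d, v p ≤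
      Real.exp (-(R : ℝ)) * Real.exp (Real.exp 1 * t * ∑ p ∈ T, v p) := by
  have hnn : ∀ d : Finset P, 0 ≤ ∏ p ∈ d, v p := fun d => Finset.prod_nonneg fun p _ => hv p
  refine le_trans ?_ (mul_le_mul_of_nonneg_left
    (sum_powerset_pow_card_le T v hv (t := Real.exp 1 * t) (by positivity)) (Real.exp_pos _).le)
  rw [Finset.mul_sum]
  refine (Finset.sum_le_sum fun d hd => ?_).trans
    (Finset.sum_le_sum_of_subset_of_nonneg (Finset.filter_subset _ _) fun d _ _ =>
      mul_nonneg (Real.exp_pos _).le (mul_nonneg (by positivity) (hnn d)))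
  have hR : (R : ℝ) ≤ d.card := by exact_mod_cast (Finset.mem_filter.1 hd).2
  have h1 : Real.exp (-(R : ℝ)) * ((Real.exp 1 * t) ^ d.card * ∏ p ∈ d, v p) =
      Real.exp (d.card - R) * (t ^ d.card * ∏ p ∈ d, v p) := by
    rw [mul_pow, ← Real.exp_nat_mul, mul_one, sub_eq_add_neg, Real.exp_add]
    ring
  rw [h1]
  exact le_mul_of_one_le_left (mul_nonneg (by positivity) (hnn d))
    (Real.one_le_exp (by linarith))

namespace RegularNorm

variable (D : RegularNorm N)

open Classical in
theorem card_filter_le_ball (e : FreeMon P) (y : ℝ) :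
    ((D.ball y).filter (e ≤ ·)).card = (D.ball (y / normM N e)).card := by
  have he := D.one_le_norm e
  symm
  refine Finset.card_bij (fun m _ => e + m) (fun m hm => ?_) (fun m _ n _ h => ?_) fun m hm => ?_
  · rw [Finset.mem_filter, D.mem_ball, normM_add, Nat.cast_mul]
    rw [D.mem_ball, le_div_iff₀ (by linarith)] at hm
    exact ⟨by linarith, le_self_add⟩
  · exact add_left_cancel h
  · obtain ⟨h1, h2⟩ := Finset.mem_filter.1 hm
    refine ⟨m - e, ?_, add_tsub_cancel_of_le h2⟩
    rw [D.mem_ball, le_div_iff₀ (by linarith)]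
    rw [← add_tsub_cancel_of_le h2, D.mem_ball, normM_add, Nat.cast_mul] at h1
    linarith

open Classical in
theorem sum_ball_sum_subset {E : Type*} [AddCommMonoid E] (𝒟 : Finset (Finset P))
    (f : Finset P → E) (y : ℝ) :
    ∑ m ∈ D.ball y, ∑ d ∈ 𝒟 with d ⊆ m.support, f d =
      ∑ d ∈ 𝒟, (D.ball (y / normM N (sqf d))).card • f d := by
  simp_rw [Finset.sum_filter]
  rw [Finset.sum_comm]
  refine Finset.sum_congr rfl fun d _ => ?_
  rw [← Finset.sum_filter, Finset.sum_const, ← D.card_filter_le_ball]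
  simp_rw [sqf_le_iff]

/-- Expand (1 + ζ)^ω over sets d of small primes, keep |d| < R, and count the multiples of each d.
The main terms are completed to the full product. Truncating and completing each cost a factor
e^(-R); the counting errors stay controlled because the retained d have norm at most w^R ≤ y. -/
theorem norm_sum_pow_omegaLe_sub_le {ζ : ℂ} (hζ : ‖1 + ζ‖ ≤ 1) {w y : ℝ} (hw : 1 ≤ w) {R : ℕ}
    (hy : w ^ R ≤ y) :
    ‖∑ m ∈ D.ball y, (1 + ζ) ^ D.omegaLe w m -
        (D.κ * D.g y : ℝ) * ∏ p ∈ D.primes w, (1 + ζ * (N p : ℂ)⁻¹)‖ ≤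
      2 * D.K * Real.exp (Real.exp 1 * ‖ζ‖ * D.invSum w) *
        (y * Real.exp (-(R : ℝ)) + y ^ D.θ * w ^ R) := by
  classical
  have hy1 : 1 ≤ y := (one_le_pow₀ hw).trans hy
  have hy0 : 0 < y := by linarith
  set T := D.primes w with hT
  have hw0 : 0 < w := by linarith
  set E := Real.exp (Real.exp 1 * ‖ζ‖ * D.invSum w) with hE
  have hE0 : 0 < E := Real.exp_pos _
  set v : P → ℝ := fun p => (N p : ℝ)⁻¹ with hv
  have hv0 : ∀ p, 0 ≤ v p := fun p => by positivity
  have hnv : ∀ d : Finset P, ((normM N (sqf d) : ℝ))⁻¹ = ∏ p ∈ d, v p := fun d => by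
    rw [normM_sqf, Nat.cast_prod, Finset.prod_inv_distrib]
  have hn1 : ∀ d : Finset P, (1 : ℝ) ≤ normM N (sqf d) := fun d => D.one_le_norm _
  have hvd : ∀ d : Finset P, 0 ≤ ∏ p ∈ d, v p := fun d => Finset.prod_nonneg fun p _ => hv0 p
  have htail : ∑ d ∈ T.powerset with R ≤ d.card, ‖ζ‖ ^ d.card * ∏ p ∈ d, v p ≤
      Real.exp (-(R : ℝ)) * E := sum_powerset_le_of_le_card T v hv0 (norm_nonneg _) R
  set 𝒟 := T.powerset.filter fun d => d.card < R with h𝒟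
  -- the truncation of the binomial expansion
  have hI : ‖∑ m ∈ D.ball y, ((1 + ζ) ^ D.omegaLe w m -
      ∑ d ∈ 𝒟 with d ⊆ m.support, ζ ^ d.card)‖ ≤ D.K * y * (Real.exp (-(R : ℝ)) * E) := by
    have h1 : ∀ m ∈ D.ball y, ‖(1 + ζ) ^ D.omegaLe w m -
        ∑ d ∈ 𝒟 with d ⊆ m.support, ζ ^ d.card‖ ≤
        ∑ d ∈ T.powersetCard R with d ⊆ m.support, ‖ζ‖ ^ R := by
      intro m _
      have h2 := norm_pow_card_sub_sum_le hζ R (T ∩ m.support)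
      have h3 : (T ∩ m.support).powerset.filter (fun d => d.card < R) =
          𝒟.filter fun d => d ⊆ m.support := by
        ext d
        simp only [h𝒟, Finset.mem_filter, Finset.mem_powerset, Finset.subset_inter_iff]
        tauto
      have h4 : (T.powersetCard R).filter (fun d => d ⊆ m.support) =
          (T ∩ m.support).powersetCard R := by
        ext d
        simp only [Finset.mem_filter, Finset.mem_powersetCard, Finset.subset_inter_iff]
        tauto
      rw [h3] at h2
      rw [h4, Finset.sum_const, Finset.card_powersetCard, nsmul_eq_mul]
      exact h2
    refine (norm_sum_le_of_le _ h1).trans ?_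
    rw [D.sum_ball_sum_subset]
    calc ∑ d ∈ T.powersetCard R, (D.ball (y / normM N (sqf d))).card • ‖ζ‖ ^ R
        ≤ ∑ d ∈ T.powersetCard R, D.K * y * (‖ζ‖ ^ d.card * ∏ p ∈ d, v p) := by
          refine Finset.sum_le_sum fun d hd => ?_
          rw [(Finset.mem_powersetCard.1 hd).2, nsmul_eq_mul, ← hnv]
          have := D.card_ball_le (y := y / normM N (sqf d)) (by positivity)
          calc ((D.ball (y / normM N (sqf d))).card : ℝ) * ‖ζ‖ ^ R
              ≤ D.K * (y / normM N (sqf d)) * ‖ζ‖ ^ R := by gcongr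
            _ = _ := by ring
      _ ≤ ∑ d ∈ T.powerset with R ≤ d.card, D.K * y * (‖ζ‖ ^ d.card * ∏ p ∈ d, v p) := by
          refine Finset.sum_le_sum_of_subset_of_nonneg (fun d hd => ?_) fun d _ _ => ?_
          · obtain ⟨h2, h3⟩ := Finset.mem_powersetCard.1 hd
            exact Finset.mem_filter.2 ⟨Finset.mem_powerset.2 h2, h3.ge⟩
          · have := hvd d
            have := D.K_pos
            positivity
      _ ≤ _ := by
          rw [← Finset.mul_sum]
          exact mul_le_mul_of_nonneg_left htail (mul_nonneg D.K_pos.le hy0.le)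
  -- the counting errors
  have hII : ‖∑ d ∈ 𝒟, ζ ^ d.card * ((((D.ball (y / normM N (sqf d))).card : ℝ) -
      D.κ * D.g y * ∏ p ∈ d, v p : ℝ) : ℂ)‖ ≤ D.C * y ^ D.θ * w ^ R * E := by
    have h1 : ∀ d ∈ 𝒟, ‖ζ ^ d.card * ((((D.ball (y / normM N (sqf d))).card : ℝ) -
        D.κ * D.g y * ∏ p ∈ d, v p : ℝ) : ℂ)‖ ≤
        D.C * y ^ D.θ * w ^ R * (‖ζ‖ ^ d.card * ∏ p ∈ d, v p) := by
      intro d hd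
      obtain ⟨hdT, hdR⟩ := Finset.mem_filter.1 hd
      have hdw : (normM N (sqf d) : ℝ) ≤ w ^ R := by
        rw [normM_sqf, Nat.cast_prod]
        calc ∏ p ∈ d, (N p : ℝ) ≤ ∏ p ∈ d, w := by
              refine Finset.prod_le_prod (fun p _ => by positivity) fun p hp => ?_
              exact D.mem_primes.1 (Finset.mem_powerset.1 hdT hp)
          _ = w ^ d.card := Finset.prod_const _
          _ ≤ w ^ R := pow_le_pow_right₀ hw hdR.le
      have hn := hn1 d
      have hn0 : (0 : ℝ) < normM N (sqf d) := by linarith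
      have h2 := D.card_ball (y := y / normM N (sqf d))
        ((one_le_div hn0).2 (hdw.trans hy))
      rw [D.g_div _ _ hy0] at h2
      have h3 : D.κ * D.g y * ∏ p ∈ d, v p = D.κ * (D.g y / normM N (sqf d)) := by
        rw [← hnv]
        ring
      rw [norm_mul, norm_pow, Complex.norm_real, Real.norm_eq_abs, h3]
      calc ‖ζ‖ ^ d.card * |((D.ball (y / normM N (sqf d))).card : ℝ) -
            D.κ * (D.g y / normM N (sqf d))|
          ≤ ‖ζ‖ ^ d.card * (D.C * (y / normM N (sqf d)) ^ D.θ) := by gcongr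
        _ ≤ ‖ζ‖ ^ d.card * (D.C * y ^ D.θ) := by
            have := D.C_nonneg
            have := D.θ_nonneg
            gcongr
            exact div_le_self hy0.le hn
        -- The factor w^R/N(d) ≥ 1 restores the weight 1/N(d), so that the sum over d is bounded by
        -- the same exponential as the other errors.
        _ ≤ ‖ζ‖ ^ d.card * (D.C * y ^ D.θ) * (w ^ R * (normM N (sqf d) : ℝ)⁻¹) := by
            refine le_mul_of_one_le_right ?_ ?_
            · have := D.C_nonneg
              positivity
            · rw [← div_eq_mul_inv]
              exact (one_le_div hn0).2 hdw
        _ = _ := by rw [hnv]; ring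
    refine (norm_sum_le_of_le _ h1).trans ?_
    rw [← Finset.mul_sum]
    have hC := D.C_nonneg
    refine mul_le_mul_of_nonneg_left ?_ (by positivity)
    calc ∑ d ∈ 𝒟, ‖ζ‖ ^ d.card * ∏ p ∈ d, v p
        ≤ ∑ d ∈ T.powerset, ‖ζ‖ ^ d.card * ∏ p ∈ d, v p :=
          Finset.sum_le_sum_of_subset_of_nonneg (Finset.filter_subset _ _) fun d _ _ =>
            mul_nonneg (by positivity) (hvd d)
      _ ≤ Real.exp (‖ζ‖ * ∑ p ∈ T, v p) := sum_powerset_pow_card_le T v hv0 (norm_nonneg _)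
      _ ≤ E := by
          refine Real.exp_le_exp.2 ?_
          have h0 : 0 ≤ ‖ζ‖ * D.invSum w := mul_nonneg (norm_nonneg _) (D.invSum_nonneg w)
          have h1 : (1 : ℝ) ≤ Real.exp 1 := Real.one_le_exp zero_le_one
          have h2 := le_mul_of_one_le_left h0 h1
          rw [← mul_assoc] at h2
          exact h2
  -- the tail of the product
  have hIII : ‖((D.κ * D.g y : ℝ) : ℂ) *
      ∑ d ∈ T.powerset with ¬ d.card < R, ζ ^ d.card * ((∏ p ∈ d, v p : ℝ) : ℂ)‖ ≤
      D.κ * y * (Real.exp (-(R : ℝ)) * E) := by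
    have hg := D.g_pos hy1
    have hκ := D.κ_pos
    rw [norm_mul, Complex.norm_real, Real.norm_eq_abs, abs_of_pos (by positivity)]
    refine mul_le_mul (mul_le_mul_of_nonneg_left (D.g_le y hy1) hκ.le) ?_ (norm_nonneg _)
      (by positivity)
    simp only [not_lt]
    refine (norm_sum_le_of_le _ fun d _ => ?_).trans htail
    rw [norm_mul, norm_pow, Complex.norm_real, Real.norm_of_nonneg (hvd d)]
  have hprod : ∏ p ∈ T, (1 + ζ * (N p : ℂ)⁻¹) =
      ∑ d ∈ T.powerset, ζ ^ d.card * ((∏ p ∈ d, v p : ℝ) : ℂ) := by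
    rw [Finset.prod_one_add]
    refine Finset.sum_congr rfl fun d _ => ?_
    rw [Finset.prod_mul_distrib, Finset.prod_const]
    simp [hv]
  have hsplit := Finset.sum_filter_add_sum_filter_not T.powerset (fun d => d.card < R)
    fun d => ζ ^ d.card * ((∏ p ∈ d, v p : ℝ) : ℂ)
  have hsum : ∑ m ∈ D.ball y, ∑ d ∈ 𝒟 with d ⊆ m.support, ζ ^ d.card =
      ∑ d ∈ 𝒟, ((D.ball (y / normM N (sqf d))).card : ℂ) * ζ ^ d.card := by
    rw [D.sum_ball_sum_subset]
    simp only [nsmul_eq_mul]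
  have hkey : ∑ m ∈ D.ball y, (1 + ζ) ^ D.omegaLe w m -
        (D.κ * D.g y : ℝ) * ∏ p ∈ D.primes w, (1 + ζ * (N p : ℂ)⁻¹) =
      ∑ m ∈ D.ball y, ((1 + ζ) ^ D.omegaLe w m - ∑ d ∈ 𝒟 with d ⊆ m.support, ζ ^ d.card) +
      ∑ d ∈ 𝒟, ζ ^ d.card * ((((D.ball (y / normM N (sqf d))).card : ℝ) -
        D.κ * D.g y * ∏ p ∈ d, v p : ℝ) : ℂ) -
      ((D.κ * D.g y : ℝ) : ℂ) *
        ∑ d ∈ T.powerset with ¬ d.card < R, ζ ^ d.card * ((∏ p ∈ d, v p : ℝ) : ℂ) := by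
    rw [← hT, hprod, ← hsplit, Finset.sum_sub_distrib, hsum]
    have : ∑ d ∈ 𝒟, ζ ^ d.card * ((((D.ball (y / normM N (sqf d))).card : ℝ) -
        D.κ * D.g y * ∏ p ∈ d, v p : ℝ) : ℂ) =
        ∑ d ∈ 𝒟, ((D.ball (y / normM N (sqf d))).card : ℂ) * ζ ^ d.card -
        ((D.κ * D.g y : ℝ) : ℂ) * ∑ d ∈ 𝒟, ζ ^ d.card * ((∏ p ∈ d, v p : ℝ) : ℂ) := by
      rw [Finset.mul_sum, ← Finset.sum_sub_distrib]
      refine Finset.sum_congr rfl fun d _ => ?_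
      push_cast
      ring
    rw [this]
    ring
  rw [hkey]
  refine (norm_sub_le _ _).trans ((add_le_add ((norm_add_le _ _).trans (add_le_add hI hII))
    hIII).trans ?_)
  have hκ := D.κ_pos
  have hC := D.C_nonneg
  have hyθ : 0 ≤ y ^ D.θ * w ^ R * E := by positivity
  have hyR : 0 ≤ y * (Real.exp (-(R : ℝ)) * E) := by positivity
  have h1 : 2 * D.K * E * (y * Real.exp (-(R : ℝ)) + y ^ D.θ * w ^ R) =
      2 * D.K * (y * (Real.exp (-(R : ℝ)) * E)) + 2 * D.K * (y ^ D.θ * w ^ R * E) := by ring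
  rw [h1, K]
  nlinarith [mul_nonneg hC hyR, mul_nonneg hκ.le hyθ, mul_nonneg hC hyθ]

end RegularNorm

/-! ### The decomposition m = k a + b of k-full elements -/

/-- The quotient digit in the decomposition `n = k u + v` with `v = 0` or `k < v < 2 k`. -/
def quotDigit (k n : ℕ) : ℕ := if k ∣ n then n / k else n / k - 1

/-- The remainder digit in the decomposition `n = k u + v` with `v = 0` or `k < v < 2 k`. -/
def remDigit (k n : ℕ) : ℕ := if k ∣ n then 0 else n % k + k

theorem quotDigit_add_remDigit {k n : ℕ} (hk : 1 ≤ k) (h : n = 0 ∨ k ≤ n) :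
    k * quotDigit k n + remDigit k n = n := by
  rw [quotDigit, remDigit]
  split_ifs with hd
  · rw [add_zero, Nat.mul_div_cancel' hd]
  · have h1 : k ≤ n := h.resolve_left fun h0 => hd (h0 ▸ dvd_zero k)
    have h2 : 1 ≤ n / k := (Nat.one_le_div_iff hk).2 h1
    have h3 := Nat.div_add_mod n k
    obtain ⟨u, hu⟩ := Nat.exists_eq_add_of_le h2
    rw [hu] at h3 ⊢
    rw [Nat.add_sub_cancel_left]
    linarith

theorem remDigit_mem {k : ℕ} (hk : 1 ≤ k) (n : ℕ) :
    remDigit k n = 0 ∨ (k < remDigit k n ∧ remDigit k n < 2 * k) := by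
  rw [remDigit]
  split_ifs with hd
  · exact Or.inl rfl
  · have h1 : 0 < n % k := Nat.pos_of_ne_zero fun h => hd (Nat.dvd_of_mod_eq_zero h)
    have h2 := Nat.mod_lt n hk
    right
    omega

/-- The allowed remainders 0, k+1, ..., 2k-1 represent each residue class modulo k once, which gives
uniqueness. Shifting the nonzero ones by k makes every k a + b k-full. -/
theorem digits_mul_add {k b : ℕ} (hk : 1 ≤ k) (a : ℕ) (hb : b = 0 ∨ (k < b ∧ b < 2 * k)) :
    quotDigit k (k * a + b) = a ∧ remDigit k (k * a + b) = b := by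
  rcases hb with rfl | ⟨h1, h2⟩
  · simp [quotDigit, remDigit, Nat.mul_div_cancel_left a hk]
  · obtain ⟨c, rfl⟩ := Nat.exists_eq_add_of_lt h1
    have h3 : k * a + (k + c + 1) = (c + 1) + k * (a + 1) := by ring
    have h4 : (c + 1) % k = c + 1 := Nat.mod_eq_of_lt (by omega)
    have h5 : ¬ k ∣ k * a + (k + c + 1) := by
      rw [h3, Nat.dvd_add_left (Dvd.intro _ rfl)]
      exact Nat.not_dvd_of_pos_of_lt (Nat.succ_pos c) (by omega)
    rw [quotDigit, remDigit, if_neg h5, if_neg h5, h3, Nat.add_mul_div_left _ _ hk,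
      Nat.add_mul_mod_self_left, h4, Nat.div_eq_of_lt (by omega)]
    omega

/-- The part `a` of a `k`-full element written as `k a + b`, where the multiplicities in `b`
vanish or lie strictly between `k` and `2 k`. -/
def quotPart (k : ℕ) (m : FreeMon P) : FreeMon P :=
  m.mapRange (quotDigit k) (by simp [quotDigit])

/-- The part `b` of a `k`-full element written as `k a + b`, where the multiplicities in `b`
vanish or lie strictly between `k` and `2 k`. -/
def remPart (k : ℕ) (m : FreeMon P) : FreeMon P :=
  m.mapRange (remDigit k) (by simp [remDigit])

/-- The elements whose multiplicities vanish or lie strictly between `k` and `2 k`. -/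
def residual (P : Type*) (k : ℕ) : Set (FreeMon P) :=
  {b | ∀ p, b p = 0 ∨ (k < b p ∧ b p < 2 * k)}

theorem remPart_mem {k : ℕ} (hk : 1 ≤ k) (m : FreeMon P) : remPart k m ∈ residual P k :=
  fun p => remDigit_mem hk (m p)

theorem quotPart_add_remPart {k : ℕ} (hk : 1 ≤ k) {m : FreeMon P} (hm : m ∈ full P k) :
    k • quotPart k m + remPart k m = m := by
  ext p
  refine quotDigit_add_remDigit hk ?_
  by_cases hp : p ∈ m.support
  · exact Or.inr (hm p hp)
  · exact Or.inl (Finsupp.notMem_support_iff.1 hp)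

theorem nsmul_add_mem_full {k : ℕ} (a : FreeMon P) {b : FreeMon P} (hb : b ∈ residual P k) :
    k • a + b ∈ full P k := by
  intro p hp
  have h1 : (k • a + b) p = k * a p + b p := rfl
  rw [Finsupp.mem_support_iff, h1] at hp
  rw [h1]
  rcases hb p with h | h
  · rw [h, add_zero] at hp ⊢
    exact Nat.le_mul_of_pos_right _ (Nat.pos_of_ne_zero (right_ne_zero_of_mul hp))
  · exact h.1.le.trans (Nat.le_add_left _ _)

theorem quotPart_nsmul_add {k : ℕ} (hk : 1 ≤ k) (a : FreeMon P) {b : FreeMon P}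
    (hb : b ∈ residual P k) : quotPart k (k • a + b) = a :=
  Finsupp.ext fun p => (digits_mul_add hk (a p) (hb p)).1

theorem remPart_nsmul_add {k : ℕ} (hk : 1 ≤ k) (a : FreeMon P) {b : FreeMon P}
    (hb : b ∈ residual P k) : remPart k (k • a + b) = b :=
  Finsupp.ext fun p => (digits_mul_add hk (a p) (hb p)).2

theorem normM_quotPart_remPart {k : ℕ} (hk : 1 ≤ k) {m : FreeMon P} (hm : m ∈ full P k) :
    normM N (quotPart k m) ^ k * normM N (remPart k m) = normM N m := by
  conv_rhs => rw [← quotPart_add_remPart hk hm]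
  rw [normM_add, normM_nsmul]

/-! ### Counting k-full elements -/

namespace RegularNorm

variable (D : RegularNorm N)

open Classical in
/-- The finite set of the `k`-full elements of norm at most `x`. -/
def fullBall (k : ℕ) (x : ℝ) : Finset (FreeMon P) := (D.ball x).filter (· ∈ full P k)

theorem mem_fullBall {k : ℕ} {x : ℝ} {m : FreeMon P} :
    m ∈ D.fullBall k x ↔ (normM N m : ℝ) ≤ x ∧ m ∈ full P k := by
  simp [fullBall, mem_ball]

theorem mem_ball_root {k : ℕ} (hk : 1 ≤ k) {x : ℝ} (hx : 0 ≤ x) (a b : FreeMon P) :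
    a ∈ D.ball ((x / normM N b) ^ (1 / (k : ℝ))) ↔
      (normM N a : ℝ) ^ k * normM N b ≤ x := by
  have hb := D.one_le_norm b
  have ha := D.one_le_norm a
  rw [mem_ball, ← le_div_iff₀ (by linarith), one_div,
    Real.le_rpow_inv_iff_of_pos (by linarith) (by positivity) (by exact_mod_cast hk),
    Real.rpow_natCast]

open Classical in
theorem sum_fullBall {E : Type*} [AddCommMonoid E] {k : ℕ} (hk : 1 ≤ k) {x : ℝ} (hx : 0 ≤ x)
    (F : FreeMon P → E) :
    ∑ m ∈ D.fullBall k x, F (quotPart k m) =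
      ∑ b ∈ D.ball x with b ∈ residual P k,
        ∑ a ∈ D.ball ((x / normM N b) ^ (1 / (k : ℝ))), F a := by
  rw [Finset.sum_sigma']
  refine Finset.sum_bij' (fun m _ => ⟨remPart k m, quotPart k m⟩) (fun s _ => k • s.2 + s.1)
    (fun m hm => ?_) (fun s hs => ?_) (fun m hm => ?_) (fun s hs => ?_) fun m hm => rfl
  · obtain ⟨h1, h2⟩ := D.mem_fullBall.1 hm
    have h3 := normM_quotPart_remPart (N := N) hk h2
    have h4 : (normM N (quotPart k m) : ℝ) ^ k * normM N (remPart k m) ≤ x := by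
      rw [← h3] at h1
      exact_mod_cast h1
    refine Finset.mem_sigma.2 ⟨Finset.mem_filter.2 ⟨D.mem_ball.2 (le_trans ?_ h4),
      remPart_mem hk m⟩, (D.mem_ball_root hk hx _ _).2 h4⟩
    exact le_mul_of_one_le_left (by positivity) (one_le_pow₀ (D.one_le_norm _))
  · obtain ⟨h1, h2⟩ := Finset.mem_sigma.1 hs
    have h3 := (Finset.mem_filter.1 h1).2
    have h4 := (D.mem_ball_root hk hx _ _).1 h2
    refine D.mem_fullBall.2 ⟨?_, nsmul_add_mem_full _ h3⟩
    rw [normM_add, normM_nsmul]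
    exact_mod_cast h4
  · exact quotPart_add_remPart hk (D.mem_fullBall.1 hm).2
  · have h3 := (Finset.mem_filter.1 (Finset.mem_sigma.1 hs).1).2
    simp only [quotPart_nsmul_add hk _ h3, remPart_nsmul_add hk _ h3]

theorem ball_root_eq_empty {k : ℕ} (hk : 1 ≤ k) {x : ℝ} (hx : 0 ≤ x) {b : FreeMon P}
    (hb : b ∉ D.ball x) : D.ball ((x / normM N b) ^ (1 / (k : ℝ))) = ∅ := by
  have h1 := D.one_le_norm b
  rw [D.mem_ball, not_le] at hb
  refine D.ball_eq_empty (Real.rpow_lt_one (by positivity) ((div_lt_one (by linarith)).2 hb) ?_)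
  have : (1 : ℝ) ≤ k := by exact_mod_cast hk
  positivity

-- Summing over all b gives an index set independent of x, as dominated convergence requires; the
-- inner ball is empty once N(b) > x.
open Classical in
theorem sum_fullBall_eq_tsum {E : Type*} [NormedAddCommGroup E] {k : ℕ} (hk : 1 ≤ k) {x : ℝ}
    (hx : 0 ≤ x) (F : FreeMon P → E) :
    ∑ m ∈ D.fullBall k x, F (quotPart k m) =
      ∑' b : FreeMon P, if b ∈ residual P k then
        ∑ a ∈ D.ball ((x / normM N b) ^ (1 / (k : ℝ))), F a else 0 := by
  rw [D.sum_fullBall hk hx, tsum_eq_sum (s := D.ball x), Finset.sum_filter]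
  intro b hb
  rw [D.ball_root_eq_empty hk hx hb, Finset.sum_empty, ite_self]

theorem div_rpow_root {k : ℕ} {x : ℝ} (hx : 0 ≤ x) (b : FreeMon P) :
    (x / normM N b) ^ (1 / (k : ℝ)) =
      x ^ (1 / (k : ℝ)) * (normM N b : ℝ) ^ (-(1 / (k : ℝ))) := by
  rw [div_eq_mul_inv, Real.mul_rpow hx (by positivity), Real.inv_rpow (by positivity),
    Real.rpow_neg (by positivity)]

-- A multiplicity l in b is at least k + 1, so N(p)^(-l/k) ≤ N(p)^(-1-1/k), and each prime has fewer
-- than k such l. The Euler product bound then reduces the claim to the prime zeta function at 1 +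
-- 1/k.
open Classical in
theorem summable_residual (D : RegularNorm N) [Countable P] {k : ℕ} (hk : 1 ≤ k) :
    Summable fun b : FreeMon P =>
      if b ∈ residual P k then (normM N b : ℝ) ^ (-(1 / (k : ℝ))) else 0 := by
  have hk0 : (0 : ℝ) < k := by exact_mod_cast hk
  set f : P → ℕ → ℝ := fun p l =>
    if k < l ∧ l < 2 * k then (N p : ℝ) ^ ((l : ℝ) * (-(1 / (k : ℝ)))) else 0 with hf
  have hf0 : ∀ p l, 0 ≤ f p l := fun p l => by
    simp only [hf]
    split_ifs <;> positivity
  have hs := D.summable_prime (δ := 1 / k) (by positivity)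
  refine summable_of_sum_le (c := Real.exp (k * D.primeSum (1 / k))) (fun b => ?_) fun T => ?_
  · simp only [Pi.zero_apply]
    split_ifs <;> positivity
  · refine le_trans (Finset.sum_le_sum fun b _ => ?_)
      (sum_prod_le_exp f hf0 (k * D.primeSum (1 / k)) (fun F L => ?_) T)
    · split_ifs with hb
      · rw [normM_rpow]
        refine le_of_eq (Finset.prod_congr rfl fun p hp => ?_)
        have := (hb p).resolve_left (Finsupp.mem_support_iff.1 hp)
        simp only [hf, this, and_self, if_true]
      · exact Finset.prod_nonneg fun p _ => hf0 p _
    · calc ∑ p ∈ F, ∑ l ∈ Finset.Ico 1 L, f p l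
          ≤ ∑ p ∈ F, k * (N p : ℝ) ^ (-(1 + 1 / (k : ℝ))) := by
            refine Finset.sum_le_sum fun p _ => ?_
            have hp := D.two_le p
            have h1 : ∑ l ∈ Finset.Ico 1 L, f p l ≤ ∑ l ∈ Finset.Ioo k (2 * k),
                (N p : ℝ) ^ (-(1 + 1 / (k : ℝ))) := by
              simp only [hf]
              rw [← Finset.sum_filter]
              refine (Finset.sum_le_sum fun l hl => ?_).trans
                (Finset.sum_le_sum_of_subset_of_nonneg (fun l hl => ?_) fun _ _ _ => by positivity)
              · have hkl : (k : ℝ) + 1 ≤ l := by exact_mod_cast (Finset.mem_filter.1 hl).2.1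
                refine Real.rpow_le_rpow_of_exponent_le (by linarith) ?_
                rw [mul_neg, neg_le_neg_iff, mul_one_div, le_div_iff₀ hk0]
                field_simp
                linarith
              · exact Finset.mem_Ioo.2 (Finset.mem_filter.1 hl).2
            refine h1.trans ?_
            rw [Finset.sum_const, nsmul_eq_mul, Nat.card_Ioo]
            gcongr
            omega
        _ ≤ k * D.primeSum (1 / k) := by
            rw [← Finset.mul_sum]
            gcongr
            exact hs.sum_le_tsum _ fun p _ => by positivity

open Classical in
theorem exists_card_fullBall_le [Countable P] {k : ℕ} (hk : 1 ≤ k) :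
    ∃ C : ℝ, 0 < C ∧ ∀ x : ℝ, 0 ≤ x → ((D.fullBall k x).card : ℝ) ≤ C * x ^ (1 / (k : ℝ)) := by
  have hs := D.summable_residual hk
  have hK := D.K_pos
  set f : FreeMon P → ℝ := fun b =>
    if b ∈ residual P k then (normM N b : ℝ) ^ (-(1 / (k : ℝ))) else 0 with hf
  have hf0 : ∀ b, 0 ≤ f b := fun b => by
    simp only [hf]
    split_ifs <;> positivity
  have hfs : 0 ≤ ∑' b, f b := tsum_nonneg hf0
  refine ⟨D.K * (∑' b, f b + 1), by positivity, fun x hx => ?_⟩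
  have h1 := D.sum_fullBall hk hx fun _ => (1 : ℝ)
  simp only [Finset.sum_const, nsmul_eq_mul, mul_one] at h1
  rw [h1]
  calc ∑ b ∈ D.ball x with b ∈ residual P k,
        ((D.ball ((x / normM N b) ^ (1 / (k : ℝ)))).card : ℝ)
      ≤ ∑ b ∈ D.ball x with b ∈ residual P k, D.K * x ^ (1 / (k : ℝ)) * f b := by
        refine Finset.sum_le_sum fun b hb => ?_
        refine (D.card_ball_le (by positivity)).trans ?_
        rw [div_rpow_root hx]
        simp only [hf, if_pos (Finset.mem_filter.1 hb).2]
        apply le_of_eq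
        ring
    _ ≤ D.K * x ^ (1 / (k : ℝ)) * ∑' b, f b := by
        rw [← Finset.mul_sum]
        gcongr
        exact hs.sum_le_tsum _ fun b _ => hf0 b
    _ ≤ D.K * x ^ (1 / (k : ℝ)) * (∑' b, f b + 1) := by
        gcongr
        linarith
    _ = _ := by ring

/-- The elements k a, that is b = 0, already have the right order of magnitude. -/
theorem exists_le_card_fullBall {k : ℕ} (hk : 1 ≤ k) :
    ∃ c : ℝ, 0 < c ∧ ∀ x : ℝ, 1 ≤ x → c * x ^ (1 / (k : ℝ)) ≤ ((D.fullBall k x).card : ℝ) := by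
  classical
  obtain ⟨c, hc, h⟩ := D.exists_le_card_ball
  refine ⟨c, hc, fun x hx => (h _ (Real.one_le_rpow hx (by positivity))).trans ?_⟩
  have h0 : (0 : FreeMon P) ∈ residual P k := fun p => Or.inl rfl
  have : (D.ball (x ^ (1 / (k : ℝ)))).card ≤ (D.fullBall k x).card := by
    refine Finset.card_le_card_of_injOn (fun a => k • a + 0) (fun a ha => ?_) fun a _ a' _ h => ?_
    · have h1 : a ∈ D.ball ((x / normM N (0 : FreeMon P)) ^ (1 / (k : ℝ))) := by
        simpa [normM_zero] using ha
      refine D.mem_fullBall.2 ⟨?_, nsmul_add_mem_full a h0⟩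
      rw [normM_add, normM_nsmul]
      exact_mod_cast (D.mem_ball_root hk (by linarith) _ _).1 h1
    · rw [← quotPart_nsmul_add hk a h0, ← quotPart_nsmul_add hk a' h0]
      exact congrArg _ h
  exact_mod_cast this

-- Erasing p leaves a k-full element whose norm is smaller by the factor N(p)^l.
open Classical in
theorem card_filter_apply_eq_le {k l : ℕ} (x : ℝ) (p : P) :
    ((D.fullBall k x).filter fun m => m p = l).card ≤ (D.fullBall k (x / (N p : ℝ) ^ l)).card := by
  have hp := D.two_le p
  refine Finset.card_le_card_of_injOn (fun m => m.erase p) (fun m hm => ?_) fun m hm n hn h => ?_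
  · obtain ⟨h1, h2⟩ := Finset.mem_filter.1 hm
    obtain ⟨h3, h4⟩ := D.mem_fullBall.1 h1
    refine D.mem_fullBall.2 ⟨?_, fun q hq => ?_⟩
    · rw [le_div_iff₀ (by positivity)]
      have : normM N m = N p ^ l * normM N (m.erase p) := by
        conv_lhs => rw [← Finsupp.single_add_erase p m]
        rw [normM_add, normM_single, h2]
      rw [this] at h3
      push_cast at h3
      linarith
    · rw [Finsupp.support_erase, Finset.mem_erase] at hq
      rw [Finsupp.erase_ne hq.1]
      exact h4 q hq.2
  · rw [← Finsupp.single_add_erase p m, ← Finsupp.single_add_erase p n]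
    have h1 := (Finset.mem_filter.1 hm).2
    have h2 := (Finset.mem_filter.1 hn).2
    simp only at h
    rw [h1, h2, h]

/-- A first moment bound for additive functions: up to a constant, multiplicity l at p has
probability at most N(p)^(-l/k). -/
theorem sum_fullBall_sum_support_le {k : ℕ} {C : ℝ}
    (hC : ∀ x : ℝ, 0 ≤ x → ((D.fullBall k x).card : ℝ) ≤ C * x ^ (1 / (k : ℝ)))
    (c : P → ℕ → ℝ) (hc : ∀ p l, 0 ≤ c p l) (H : ℝ)
    (hH : ∀ (F : Finset P) (L : ℕ), ∑ p ∈ F, ∑ l ∈ Finset.Ico 1 L,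
      c p l * ((N p : ℝ) ^ (-(1 / (k : ℝ)))) ^ l ≤ H) {x : ℝ} (hx : 0 ≤ x) :
    ∑ m ∈ D.fullBall k x, ∑ p ∈ m.support, c p (m p) ≤ C * x ^ (1 / (k : ℝ)) * H := by
  classical
  have hC0 : 0 ≤ C := by
    have := hC 1 zero_le_one
    rw [Real.one_rpow, mul_one] at this
    exact le_trans (Nat.cast_nonneg _) this
  set T := D.fullBall k x with hT
  set S : Finset P := T.biUnion fun m => m.support with hS
  set L : ℕ := T.sup fun m => m.support.sup m with hL
  have h1 : ∀ m ∈ T, ∑ p ∈ m.support, c p (m p) ≤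
      ∑ p ∈ S, ∑ l ∈ Finset.Ico 1 (L + 1), if m p = l then c p l else 0 := by
    intro m hm
    refine le_trans (Finset.sum_le_sum fun p hp => ?_) (Finset.sum_le_sum_of_subset_of_nonneg
      (Finset.subset_biUnion_of_mem (fun m : FreeMon P => m.support) hm) fun p _ _ =>
        Finset.sum_nonneg fun l _ => by split_ifs <;> simp [hc])
    rw [Finset.sum_ite_eq, if_pos]
    refine Finset.mem_Ico.2 ⟨Nat.one_le_iff_ne_zero.2 (Finsupp.mem_support_iff.1 hp), ?_⟩
    exact Nat.lt_succ_of_le ((Finset.le_sup (f := m) hp).trans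
        (Finset.le_sup (f := fun m : FreeMon P => m.support.sup m) hm))
  refine (Finset.sum_le_sum h1).trans ?_
  rw [Finset.sum_comm]
  have h2 : ∀ p ∈ S, ∑ m ∈ T, ∑ l ∈ Finset.Ico 1 (L + 1), (if m p = l then c p l else 0) ≤
      ∑ l ∈ Finset.Ico 1 (L + 1),
        C * x ^ (1 / (k : ℝ)) * (c p l * ((N p : ℝ) ^ (-(1 / (k : ℝ)))) ^ l) := by
    intro p _
    rw [Finset.sum_comm]
    refine Finset.sum_le_sum fun l _ => ?_
    rw [← Finset.sum_filter, Finset.sum_const, nsmul_eq_mul]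
    have h3 : ((T.filter fun m => m p = l).card : ℝ) ≤
        C * (x ^ (1 / (k : ℝ)) * ((N p : ℝ) ^ (-(1 / (k : ℝ)))) ^ l) := by
      have h4 : ((T.filter fun m => m p = l).card : ℝ) ≤
          (D.fullBall k (x / (N p : ℝ) ^ l)).card := by
        exact_mod_cast D.card_filter_apply_eq_le x p
      refine h4.trans ((hC _ (by positivity)).trans (le_of_eq ?_))
      rw [Real.rpow_neg (by positivity), inv_pow, ← Real.rpow_mul_natCast (by positivity),
        Real.div_rpow hx (by positivity), ← Real.rpow_natCast_mul (by positivity),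
        mul_comm (l : ℝ), div_eq_mul_inv]
    calc ((T.filter fun m => m p = l).card : ℝ) * c p l
        ≤ C * (x ^ (1 / (k : ℝ)) * ((N p : ℝ) ^ (-(1 / (k : ℝ)))) ^ l) * c p l :=
          mul_le_mul_of_nonneg_right h3 (hc p l)
      _ = _ := by ring
  refine (Finset.sum_le_sum h2).trans ?_
  simp_rw [← Finset.mul_sum]
  exact mul_le_mul_of_nonneg_left (hH _ _) (mul_nonneg hC0 (by positivity))

end RegularNorm

/-! ### Asymptotics of the cutoff and of the increment -/

/-- The iterated logarithm. -/
def loglog (x : ℝ) : ℝ := Real.log (Real.log x)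

/-- The truncation point `x ^ (1 / (log log x) ^ 2)` for prime elements. -/
def cutoff (x : ℝ) : ℝ := Real.exp (Real.log x / loglog x ^ 2)

theorem tendsto_loglog : Tendsto loglog atTop atTop :=
  Real.tendsto_log_atTop.comp Real.tendsto_log_atTop

theorem tendsto_sqrt_loglog : Tendsto (fun x => √(loglog x)) atTop atTop :=
  Real.tendsto_sqrt_atTop.comp tendsto_loglog

theorem eventually_exp_loglog : ∀ᶠ x : ℝ in atTop, Real.exp (loglog x) = Real.log x := by
  filter_upwards [Real.tendsto_log_atTop.eventually_gt_atTop 0] with x hx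
  exact Real.exp_log hx

theorem tendsto_log_div_loglog_sq : Tendsto (fun x => Real.log x / loglog x ^ 2) atTop atTop := by
  refine ((Real.tendsto_exp_div_pow_atTop 2).comp tendsto_loglog).congr' ?_
  filter_upwards [eventually_exp_loglog] with x hx
  simp only [Function.comp_apply, hx]

theorem tendsto_cutoff : Tendsto cutoff atTop atTop :=
  Real.tendsto_exp_atTop.comp tendsto_log_div_loglog_sq

/-- Discarding the primes above the cutoff changes the expected number of primes by O(log L) only,
which is o(√L). -/
theorem eventually_loglog_cutoff :
    ∀ᶠ x : ℝ in atTop, loglog (cutoff x) = loglog x - 2 * Real.log (loglog x) := by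
  filter_upwards [Real.tendsto_log_atTop.eventually_gt_atTop 0,
    tendsto_loglog.eventually_gt_atTop 0] with x hx hL
  rw [loglog, cutoff, Real.log_exp, Real.log_div hx.ne' (by positivity), Real.log_pow]
  rfl

theorem tendsto_log_div_sqrt : Tendsto (fun u : ℝ => Real.log u / √u) atTop (𝓝 0) := by
  simp_rw [Real.sqrt_eq_rpow]
  exact (isLittleO_log_rpow_atTop (by norm_num)).tendsto_div_nhds_zero

theorem tendsto_const_add_log_div_sqrt_loglog (c e : ℝ) :
    Tendsto (fun x => (c + e * Real.log (loglog x)) / √(loglog x)) atTop (𝓝 0) := by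
  have h1 := (tendsto_log_div_sqrt.comp tendsto_loglog).const_mul e
  have h2 := (tendsto_inv_atTop_zero.comp tendsto_sqrt_loglog).const_mul c
  have h3 := h2.add h1
  simp only [mul_zero, add_zero] at h3
  refine h3.congr fun x => ?_
  simp only [Function.comp_apply]
  ring

theorem norm_prod_sub_prod_le_sum (T : Finset P) (u v : P → ℂ) (hu : ∀ p ∈ T, ‖u p‖ ≤ 1)
    (hv : ∀ p ∈ T, ‖v p‖ ≤ 1) : ‖∏ p ∈ T, u p - ∏ p ∈ T, v p‖ ≤ ∑ p ∈ T, ‖u p - v p‖ := by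
  classical
  induction T using Finset.induction_on with
  | empty => simp
  | insert p T hp ih =>
    rw [Finset.prod_insert hp, Finset.prod_insert hp, Finset.sum_insert hp]
    have h1 : u p * ∏ q ∈ T, u q - v p * ∏ q ∈ T, v q =
        (u p - v p) * ∏ q ∈ T, u q + v p * (∏ q ∈ T, u q - ∏ q ∈ T, v q) := by ring
    rw [h1]
    refine (norm_add_le _ _).trans ?_
    rw [norm_mul, norm_mul]
    have h2 : ‖∏ q ∈ T, u q‖ ≤ 1 := by
      rw [norm_prod]
      exact Finset.prod_le_one (fun _ _ => norm_nonneg _) fun q hq =>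
        hu q (Finset.mem_insert_of_mem hq)
    refine add_le_add (mul_le_of_le_one_right (norm_nonneg _) h2) ?_
    refine (mul_le_of_le_one_left (norm_nonneg _) (hv p (Finset.mem_insert_self _ _))).trans ?_
    exact ih (fun q hq => hu q (Finset.mem_insert_of_mem hq))
      fun q hq => hv q (Finset.mem_insert_of_mem hq)

/-- The increment `exp (i ξ / √(log log x)) - 1`. -/
def incr (ξ x : ℝ) : ℂ := Complex.exp (Complex.I * (ξ / √(loglog x) : ℝ)) - 1

theorem norm_one_add_incr (ξ x : ℝ) : ‖1 + incr ξ x‖ = 1 := by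
  rw [incr, add_sub_cancel, mul_comm, Complex.norm_exp_ofReal_mul_I]

theorem norm_incr_le (ξ x : ℝ) : ‖incr ξ x‖ ≤ |ξ| / √(loglog x) := by
  refine Real.norm_exp_I_mul_ofReal_sub_one_le.trans (le_of_eq ?_)
  rw [Real.norm_eq_abs, abs_div, abs_of_nonneg (Real.sqrt_nonneg _)]

theorem norm_incr_le_two (ξ x : ℝ) : ‖incr ξ x‖ ≤ 2 := by
  calc ‖incr ξ x‖ = ‖(1 + incr ξ x) - 1‖ := by rw [add_sub_cancel_left]
    _ ≤ ‖1 + incr ξ x‖ + ‖(1 : ℂ)‖ := norm_sub_le _ _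
    _ = 2 := by
      rw [norm_one_add_incr, norm_one]
      norm_num

theorem tendsto_const_div_sqrt_loglog (c : ℝ) :
    Tendsto (fun x => c / √(loglog x)) atTop (𝓝 0) :=
  tendsto_const_nhds.div_atTop tendsto_sqrt_loglog

theorem tendsto_norm_incr (ξ : ℝ) : Tendsto (fun x => ‖incr ξ x‖) atTop (𝓝 0) :=
  squeeze_zero (fun _ => norm_nonneg _) (norm_incr_le ξ) (tendsto_const_div_sqrt_loglog _)

/-- Taylor expansion: L (exp(iξ/√L) - 1) = iξ√L - ξ²/2 + O(L^(-1/2)). The quadratic term is the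
Gaussian exponent. -/
theorem tendsto_loglog_mul_incr (ξ : ℝ) :
    Tendsto (fun x => (loglog x : ℂ) * incr ξ x - Complex.I * (ξ * √(loglog x) : ℝ)) atTop
      (𝓝 (-(ξ ^ 2 / 2 : ℝ) : ℂ)) := by
  rw [tendsto_iff_norm_sub_tendsto_zero]
  have h0 : Tendsto (fun x => |ξ| ^ 3 / √(loglog x) * Real.exp (|ξ| / √(loglog x))) atTop
      (𝓝 0) := by
    have := (tendsto_const_div_sqrt_loglog (|ξ| ^ 3)).mul
      ((Real.continuous_exp.tendsto 0).comp (tendsto_const_div_sqrt_loglog |ξ|))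
    simpa using this
  refine squeeze_zero' (Eventually.of_forall fun _ => norm_nonneg _) ?_ h0
  filter_upwards [tendsto_loglog.eventually_gt_atTop 0] with x hL
  set L := loglog x with hLdef
  set s := √L with hs
  have hs0 : 0 < s := Real.sqrt_pos.2 hL
  have hsL : L = s ^ 2 := (Real.sq_sqrt hL.le).symm
  set z : ℂ := Complex.I * (ξ / s : ℝ) with hz
  have hzn : ‖z‖ = |ξ| / s := by
    rw [hz, norm_mul, Complex.norm_I, one_mul, Complex.norm_real, Real.norm_eq_abs, abs_div,
      abs_of_pos hs0]
  have h1 := Complex.norm_exp_sub_sum_le_norm_mul_exp z 3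
  have hsC : (s : ℂ) ≠ 0 := by exact_mod_cast hs0.ne'
  have h2 : (L : ℂ) * incr ξ x - Complex.I * (ξ * s : ℝ) - -(ξ ^ 2 / 2 : ℝ) =
      (L : ℂ) * (Complex.exp z - ∑ m ∈ Finset.range 3, z ^ m / (m.factorial : ℂ)) := by
    have hL1 : (L : ℂ) * z = Complex.I * (ξ * s : ℝ) := by
      rw [hsL, hz]
      push_cast
      field_simp
    have hL2 : (L : ℂ) * z ^ 2 = -(ξ ^ 2 : ℝ) := by
      rw [hsL, hz, mul_pow, Complex.I_sq]
      push_cast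
      field_simp
    rw [← hL1]
    have hL3 : (-(ξ ^ 2 / 2 : ℝ) : ℂ) = (L : ℂ) * z ^ 2 / 2 := by
      rw [hL2]
      push_cast
      ring
    rw [hL3, incr, ← hz]
    simp only [Finset.sum_range_succ, Finset.sum_range_zero, Nat.factorial]
    push_cast
    ring
  rw [h2, norm_mul, Complex.norm_real, Real.norm_of_nonneg hL.le]
  refine (mul_le_mul_of_nonneg_left h1 hL.le).trans (le_of_eq ?_)
  rw [hzn, hsL]
  field_simp

/-- The factor exp(A√L) bounds the exponential of the weighted prime sum. It loses against the
truncation saving e^(-L) and against the power saving x^(-c), even after the loss of w^R ≤ exp(2 log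
x / L). -/
theorem tendsto_exp_mul_error (A : ℝ) {c : ℝ} (hc : 0 < c) :
    Tendsto (fun x => Real.exp (A * √(loglog x)) * (Real.exp (-loglog x) +
      Real.exp (-(c * Real.log x) + 2 * (Real.log x / loglog x)))) atTop (𝓝 0) := by
  have h1 : Tendsto (fun x => A * √(loglog x) - loglog x) atTop atBot := by
    have h2 : Tendsto (fun x => √(loglog x) * (√(loglog x) - A)) atTop atTop :=
      tendsto_sqrt_loglog.atTop_mul_atTop₀ (tendsto_atTop_add_const_right _ (-A) tendsto_sqrt_loglog)
    refine (tendsto_neg_atTop_atBot.comp h2).congr' ?_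
    filter_upwards [tendsto_loglog.eventually_ge_atTop 0] with x hx
    have := Real.mul_self_sqrt hx
    simp only [Function.comp_apply]
    linarith
  have h3 : Tendsto (fun x => A * √(loglog x) +
      (-(c * Real.log x) + 2 * (Real.log x / loglog x))) atTop atBot := by
    have h4 : Tendsto (fun x => -(c / 2 * Real.log x)) atTop atBot :=
      tendsto_neg_atTop_atBot.comp (Real.tendsto_log_atTop.const_mul_atTop (by positivity))
    refine tendsto_atBot_mono' _ ?_ h4
    -- Of the saving c log x, a quarter pays for A√L and a quarter, by L ≥ 8/c, for 2 log x / L;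
    -- half is left.
    have h5 : ∀ᶠ x in atTop, loglog x ≤ c / (4 * (|A| + 1)) * Real.log x := by
      have h6 := (Real.isLittleO_log_id_atTop.comp_tendsto Real.tendsto_log_atTop).bound
        (show 0 < c / (4 * (|A| + 1)) by positivity)
      filter_upwards [h6, Real.tendsto_log_atTop.eventually_ge_atTop 0] with x hx hX
      simp only [Function.comp_apply, id, Real.norm_eq_abs, abs_of_nonneg hX] at hx
      exact (le_abs_self _).trans hx
    filter_upwards [h5, tendsto_loglog.eventually_ge_atTop (max 1 (8 / c)),
      Real.tendsto_log_atTop.eventually_ge_atTop 0] with x hx hL hX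
    have hL1 := (le_max_left _ _).trans hL
    have hL2 := (le_max_right _ _).trans hL
    have h7 : √(loglog x) ≤ loglog x := by
      rw [Real.sqrt_le_left (by linarith)]
      nlinarith
    have h8 : A * √(loglog x) ≤ c / 4 * Real.log x := by
      calc A * √(loglog x) ≤ (|A| + 1) * loglog x := by
            refine mul_le_mul ?_ h7 (Real.sqrt_nonneg _) (by positivity)
            linarith [le_abs_self A]
        _ ≤ (|A| + 1) * (c / (4 * (|A| + 1)) * Real.log x) := by gcongr
        _ = _ := by field_simp
    have h9 : 2 * (Real.log x / loglog x) ≤ c / 4 * Real.log x := by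
      rw [← mul_div_assoc, div_le_iff₀ (by linarith)]
      rw [div_le_iff₀ hc] at hL2
      nlinarith
    linarith
  have h := (Real.tendsto_exp_atBot.comp h1).add (Real.tendsto_exp_atBot.comp h3)
  rw [add_zero] at h
  refine h.congr fun x => ?_
  simp only [Function.comp_apply]
  rw [sub_eq_add_neg, Real.exp_add, Real.exp_add _ (_ + _)]
  ring

/-! ### The Gaussian limit of the Euler product -/

namespace RegularNorm

variable (D : RegularNorm N)

theorem tendsto_invSum_sub [Countable P] :
    Tendsto (fun x => (D.invSum x - loglog x) / √(loglog x)) atTop (𝓝 0) := by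
  obtain ⟨C₁, h⟩ := D.exists_abs_invSum_sub_le
  refine squeeze_zero_norm' ?_ (tendsto_const_add_log_div_sqrt_loglog C₁ 1)
  filter_upwards [h] with x hx
  rw [norm_div, Real.norm_eq_abs, Real.norm_of_nonneg (Real.sqrt_nonneg _), one_mul]
  gcongr
  exact hx

theorem tendsto_invSum_cutoff_sub [Countable P] :
    Tendsto (fun x => (D.invSum (cutoff x) - loglog x) / √(loglog x)) atTop (𝓝 0) := by
  obtain ⟨C₁, h⟩ := D.exists_abs_invSum_sub_le
  refine squeeze_zero_norm' ?_ (tendsto_const_add_log_div_sqrt_loglog C₁ 3)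
  filter_upwards [tendsto_cutoff.eventually h, eventually_loglog_cutoff,
    (tendsto_loglog.comp tendsto_cutoff).eventually_gt_atTop 0,
    tendsto_loglog.eventually_ge_atTop 1] with x hx hc hc0 hL
  rw [norm_div, Real.norm_eq_abs, Real.norm_of_nonneg (Real.sqrt_nonneg _)]
  gcongr
  change |D.invSum (cutoff x) - loglog (cutoff x)| ≤ C₁ + Real.log (loglog (cutoff x)) at hx
  have hlog := Real.log_nonneg hL
  have h1 : Real.log (loglog (cutoff x)) ≤ Real.log (loglog x) :=
    Real.log_le_log hc0 (by rw [hc]; linarith)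
  have h2 := abs_le.1 hx
  rw [abs_le]
  constructor <;> linarith

theorem eventually_invSum_cutoff_le [Countable P] :
    ∀ᶠ x in atTop, D.invSum (cutoff x) ≤ 2 * loglog x := by
  filter_upwards [D.tendsto_invSum_cutoff_sub.eventually_le_const one_pos,
    tendsto_loglog.eventually_ge_atTop 1] with x hx hL
  have h0 : 0 < √(loglog x) := Real.sqrt_pos.2 (by linarith)
  have h7 : √(loglog x) ≤ loglog x := by
    rw [Real.sqrt_le_left (by linarith)]
    nlinarith
  rw [div_le_iff₀ h0] at hx
  linarith

/-- Replacing 1 + ζ/N(p) by exp(ζ/N(p)) costs |ζ|² ∑ N(p)^(-2), which tends to 0. In the exponent, ∑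
1/N(p) may be replaced by L, since the difference is o(√L) and ζ = O(1/√L). -/
theorem tendsto_prod_incr [Countable P] (ξ : ℝ) :
    Tendsto (fun x => Complex.exp (-(Complex.I * (ξ * √(loglog x) : ℝ))) *
      ∏ p ∈ D.primes (cutoff x), (1 + incr ξ x * (N p : ℂ)⁻¹)) atTop
      (𝓝 (Complex.exp (-(ξ ^ 2 / 2 : ℝ)))) := by
  have hphase : ∀ x, ‖Complex.exp (-(Complex.I * (ξ * √(loglog x) : ℝ)))‖ = 1 := fun x => by
    rw [← mul_neg, mul_comm, ← Complex.ofReal_neg, Complex.norm_exp_ofReal_mul_I]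
  -- the comparison with an exponential
  have h1 : Tendsto (fun x => Complex.exp (-(Complex.I * (ξ * √(loglog x) : ℝ))) *
      (∏ p ∈ D.primes (cutoff x), (1 + incr ξ x * (N p : ℂ)⁻¹) -
        ∏ p ∈ D.primes (cutoff x), Complex.exp (incr ξ x * (N p : ℂ)⁻¹))) atTop (𝓝 0) := by
    have h2 : Tendsto (fun x => ‖incr ξ x‖ ^ 2 * D.primeSum 1) atTop (𝓝 0) := by
      simpa using ((tendsto_norm_incr ξ).pow 2).mul_const (D.primeSum 1)
    refine squeeze_zero_norm (fun x => ?_) h2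
    rw [norm_mul, hphase, one_mul]
    -- This places the exponential factors in the unit disc, as the comparison of products requires.
    have hre : (incr ξ x).re ≤ 0 := by
      have := Complex.re_le_norm (1 + incr ξ x)
      rw [norm_one_add_incr, Complex.add_re, Complex.one_re] at this
      linarith
    refine (norm_prod_sub_prod_le_sum _ _ _ (fun p _ => ?_) fun p _ => ?_).trans ?_
    · have hp := D.two_le p
      have hp1 : (N p : ℝ)⁻¹ ≤ 1 := inv_le_one_of_one_le₀ (by linarith)
      -- A convex combination of 1 and the unimodular number 1 + ζ, hence in the unit disc.
      have h3 : 1 + incr ξ x * (N p : ℂ)⁻¹ =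
          ((1 - (N p : ℝ)⁻¹ : ℝ) : ℂ) + (1 + incr ξ x) * ((N p : ℝ)⁻¹ : ℝ) := by
        push_cast
        ring
      rw [h3]
      refine (norm_add_le _ _).trans ?_
      rw [norm_mul, norm_one_add_incr, Complex.norm_real, Complex.norm_real,
        Real.norm_of_nonneg (by linarith), Real.norm_of_nonneg (by positivity)]
      linarith
    · have h3 : (incr ξ x * (N p : ℂ)⁻¹).re = (incr ξ x).re * (N p : ℝ)⁻¹ := by
        rw [← Complex.re_mul_ofReal]
        push_cast
        rfl
      rw [Complex.norm_exp, h3, Real.exp_le_one_iff]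
      exact mul_nonpos_of_nonpos_of_nonneg hre (by positivity)
    · have h3 : ∀ p ∈ D.primes (cutoff x), ‖1 + incr ξ x * (N p : ℂ)⁻¹ -
          Complex.exp (incr ξ x * (N p : ℂ)⁻¹)‖ ≤
          ‖incr ξ x‖ ^ 2 * (N p : ℝ) ^ (-(1 + 1) : ℝ) := by
        intro p _
        have hp := D.two_le p
        have hn : ‖incr ξ x * (N p : ℂ)⁻¹‖ = ‖incr ξ x‖ * (N p : ℝ)⁻¹ := by
          rw [norm_mul, norm_inv, Complex.norm_natCast]
        have h4 := Complex.norm_exp_sub_one_sub_id_le (x := incr ξ x * (N p : ℂ)⁻¹) (by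
          rw [hn, ← div_eq_mul_inv]
          exact (div_le_one (by linarith)).2 ((norm_incr_le_two ξ x).trans hp))
        rw [norm_sub_rev, ← sub_sub]
        refine h4.trans (le_of_eq ?_)
        rw [hn, mul_pow, inv_pow, Real.rpow_neg (by positivity), one_add_one_eq_two]
        norm_num
      refine (Finset.sum_le_sum h3).trans ?_
      rw [← Finset.mul_sum]
      gcongr
      exact (D.summable_prime one_pos).sum_le_tsum _ fun p _ => by positivity
  have h5 : Tendsto (fun x => incr ξ x * (D.invSum (cutoff x) - loglog x : ℝ)) atTop (𝓝 0) := by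
    have h6 := (D.tendsto_invSum_cutoff_sub.norm).const_mul |ξ|
    simp only [norm_zero, mul_zero] at h6
    refine squeeze_zero_norm (fun x => ?_) h6
    rw [norm_mul, Complex.norm_real, norm_div, Real.norm_of_nonneg (Real.sqrt_nonneg _)]
    calc ‖incr ξ x‖ * ‖D.invSum (cutoff x) - loglog x‖
        ≤ |ξ| / √(loglog x) * ‖D.invSum (cutoff x) - loglog x‖ := by
          gcongr
          exact norm_incr_le ξ x
      _ = _ := by ring
  have h7 := (Complex.continuous_exp.tendsto _).comp (h5.add (tendsto_loglog_mul_incr ξ))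
  have h8 := h7.add h1
  rw [zero_add, add_zero] at h8
  refine h8.congr fun x => ?_
  simp only [Function.comp_apply]
  rw [← Complex.exp_sum, ← Finset.mul_sum, mul_sub, ← Complex.exp_add]
  have h9 : incr ξ x * (D.invSum (cutoff x) - loglog x : ℝ) +
      ((loglog x : ℂ) * incr ξ x - Complex.I * (ξ * √(loglog x) : ℝ)) =
      -(Complex.I * (ξ * √(loglog x) : ℝ)) +
        incr ξ x * ∑ p ∈ D.primes (cutoff x), (N p : ℂ)⁻¹ := by
    rw [invSum]
    push_cast
    ring
  rw [h9]
  ring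

end RegularNorm

theorem rpow_eq_exp_mul_log {x : ℝ} (hx : 0 < x) (s : ℝ) : x ^ s = Real.exp (s * Real.log x) := by
  rw [Real.rpow_def_of_pos hx, mul_comm]

/-! ### Characteristic functions on balls and on k-full elements -/

namespace RegularNorm

variable (D : RegularNorm N)

/-- The character of the normalized truncated number of prime divisors. -/
def character (ξ x : ℝ) (a : FreeMon P) : ℂ :=
  Complex.exp (Complex.I * (ξ * ((D.omegaLe (cutoff x) a - loglog x) / √(loglog x)) : ℝ))

theorem norm_character (ξ x : ℝ) (a : FreeMon P) : ‖D.character ξ x a‖ = 1 := by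
  rw [character, mul_comm, Complex.norm_exp_ofReal_mul_I]

theorem character_eq {ξ x : ℝ} (hL : 0 < loglog x) (a : FreeMon P) :
    D.character ξ x a = Complex.exp (-(Complex.I * (ξ * √(loglog x) : ℝ))) *
      (1 + incr ξ x) ^ D.omegaLe (cutoff x) a := by
  rw [incr, add_sub_cancel, ← Complex.exp_nat_mul, ← Complex.exp_add, character]
  congr 1
  have hs : 0 < √(loglog x) := Real.sqrt_pos.2 hL
  have h1 : ξ * ((D.omegaLe (cutoff x) a - loglog x) / √(loglog x)) =
      -(ξ * √(loglog x)) + D.omegaLe (cutoff x) a * (ξ / √(loglog x)) := by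
    have h2 : loglog x = √(loglog x) * √(loglog x) := (Real.mul_self_sqrt hL.le).symm
    field_simp
    rw [sub_eq_neg_add, Real.sq_sqrt hL.le]
  rw [h1]
  push_cast
  ring

/-- The truncation length is R = ⌈L⌉: then e^(-R) ≤ e^(-L), while w^R ≤ exp(2 log x / L) is still
smaller than any power of x. The threshold on x may depend on b, since only pointwise limits in b
are needed. -/
theorem norm_sum_character_sub_le [Countable P] {k : ℕ} (hk : 1 ≤ k) (ξ : ℝ) (b : FreeMon P) :
    ∀ᶠ x in atTop, ‖∑ a ∈ D.ball ((x / normM N b) ^ (1 / (k : ℝ))),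
        (1 + incr ξ x) ^ D.omegaLe (cutoff x) a -
        (D.κ * D.g ((x / normM N b) ^ (1 / (k : ℝ))) : ℝ) *
          ∏ p ∈ D.primes (cutoff x), (1 + incr ξ x * (N p : ℂ)⁻¹)‖ / x ^ (1 / (k : ℝ)) ≤
      2 * D.K * (Real.exp ((2 * Real.exp 1 * |ξ|) * √(loglog x)) * (Real.exp (-loglog x) +
        Real.exp (-((1 - D.θ) / k * Real.log x) + 2 * (Real.log x / loglog x)))) := by
  have hk0 : (0 : ℝ) < k := by exact_mod_cast hk
  set ν := Real.log (normM N b) with hν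
  have hn := D.one_le_norm b
  have hν0 : 0 ≤ ν := Real.log_nonneg hn
  -- The conditions L ≥ 4k and log x ≥ 2 log N(b) ensure w^R ≤ x^(1/(2k)) ≤ y.
  filter_upwards [D.eventually_invSum_cutoff_le, tendsto_loglog.eventually_ge_atTop (max 1 (4 * k)),
    Real.tendsto_log_atTop.eventually_ge_atTop (2 * ν), eventually_gt_atTop 0,
    Real.tendsto_log_atTop.eventually_ge_atTop 0] with x hS hL hX hx0 hX0
  have hL1 := (le_max_left _ _).trans hL
  have hLk := (le_max_right _ _).trans hL
  have hK := D.K_pos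
  set L := loglog x with hLdef
  set X := Real.log x with hXdef
  have hL0 : 0 < L := by linarith
  have hs0 : 0 < √L := Real.sqrt_pos.2 hL0
  set y := (x / normM N b) ^ (1 / (k : ℝ)) with hy
  have hxk : x ^ (1 / (k : ℝ)) = Real.exp (X / k) := by
    rw [rpow_eq_exp_mul_log hx0, one_div_mul_eq_div]
  have hyexp : y = Real.exp ((X - ν) / k) := by
    rw [hy, rpow_eq_exp_mul_log (by positivity), Real.log_div hx0.ne' (by positivity),
      one_div_mul_eq_div]
  have hyle : y ≤ Real.exp (X / k) := by
    rw [hyexp, Real.exp_le_exp]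
    gcongr
    linarith
  set R := ⌈L⌉₊ with hR
  have hR1 : L ≤ R := Nat.le_ceil L
  have hR2 : (R : ℝ) ≤ 2 * L := by
    have := Nat.ceil_lt_add_one hL0.le
    linarith
  have hwR : cutoff x ^ R ≤ Real.exp (2 * (X / L)) := by
    rw [cutoff, ← Real.exp_nat_mul, Real.exp_le_exp]
    calc (R : ℝ) * (X / L ^ 2) ≤ 2 * L * (X / L ^ 2) := by gcongr
      _ = _ := by field_simp
  have hwR2 : cutoff x ^ R ≤ y := by
    refine hwR.trans ?_
    rw [hyexp, Real.exp_le_exp]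
    calc 2 * (X / L) ≤ 2 * (X / (4 * k)) := by gcongr
      _ = (X - X / 2) / k := by
        field_simp
        ring
      _ ≤ _ := by
        gcongr
        linarith
  have hw1 : 1 ≤ cutoff x := Real.one_le_exp (by positivity)
  have hmain := D.norm_sum_pow_omegaLe_sub_le (norm_one_add_incr ξ x).le hw1 hwR2
  rw [hxk, div_le_iff₀ (Real.exp_pos _)]
  refine hmain.trans ?_
  have hE : Real.exp (Real.exp 1 * ‖incr ξ x‖ * D.invSum (cutoff x)) ≤
      Real.exp ((2 * Real.exp 1 * |ξ|) * √L) := by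
    rw [Real.exp_le_exp]
    calc Real.exp 1 * ‖incr ξ x‖ * D.invSum (cutoff x)
        ≤ Real.exp 1 * (|ξ| / √L) * (2 * L) := by
          have := D.invSum_nonneg (cutoff x)
          gcongr
          exact norm_incr_le ξ x
      _ = 2 * Real.exp 1 * |ξ| * (√L * √L) / √L := by
          rw [Real.mul_self_sqrt hL0.le]
          field_simp
      _ = _ := by field_simp
  have hyθ : y ^ D.θ ≤ Real.exp (D.θ * (X / k)) := by
    calc y ^ D.θ ≤ (Real.exp (X / k)) ^ D.θ := by
          have := D.θ_nonneg
          gcongr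
      _ = _ := by rw [← Real.exp_mul, mul_comm]
  have herr : y * Real.exp (-(R : ℝ)) + y ^ D.θ * cutoff x ^ R ≤
      (Real.exp (-L) + Real.exp (-((1 - D.θ) / k * X) + 2 * (X / L))) * Real.exp (X / k) := by
    have h1 : y * Real.exp (-(R : ℝ)) ≤ Real.exp (X / k) * Real.exp (-L) := by gcongr
    have h2 : y ^ D.θ * cutoff x ^ R ≤ Real.exp (D.θ * (X / k)) * Real.exp (2 * (X / L)) := by
      have : 0 ≤ cutoff x ^ R := by positivity
      gcongr
    have h3 : Real.exp (D.θ * (X / k)) * Real.exp (2 * (X / L)) =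
        Real.exp (-((1 - D.θ) / k * X) + 2 * (X / L)) * Real.exp (X / k) := by
      rw [← Real.exp_add, ← Real.exp_add]
      congr 1
      field_simp
      ring
    linarith
  have hpos : 0 ≤ y * Real.exp (-(R : ℝ)) + y ^ D.θ * cutoff x ^ R := by
    have : 0 ≤ y := by rw [hyexp]; positivity
    have : 0 ≤ cutoff x ^ R := by positivity
    positivity
  calc 2 * D.K * Real.exp (Real.exp 1 * ‖incr ξ x‖ * D.invSum (cutoff x)) *
        (y * Real.exp (-(R : ℝ)) + y ^ D.θ * cutoff x ^ R)
      ≤ 2 * D.K * Real.exp ((2 * Real.exp 1 * |ξ|) * √L) *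
        ((Real.exp (-L) + Real.exp (-((1 - D.θ) / k * X) + 2 * (X / L))) * Real.exp (X / k)) := by
        gcongr
    _ = _ := by ring

theorem tendsto_root_atTop {k : ℕ} (hk : 1 ≤ k) {c : ℝ} (hc : 0 < c) :
    Tendsto (fun x : ℝ => (x / c) ^ (1 / (k : ℝ))) atTop atTop := by
  have hk0 : (0 : ℝ) < k := by exact_mod_cast hk
  exact (tendsto_rpow_atTop (by positivity)).comp (tendsto_id.atTop_div_const hc)

theorem root_le {k : ℕ} {x c : ℝ} (hx : 0 ≤ x) (hc : 1 ≤ c) :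
    (x / c) ^ (1 / (k : ℝ)) ≤ x ^ (1 / (k : ℝ)) := by
  have : x / c ≤ x := div_le_self hx hc
  gcongr

/-- The limit value is subtracted inside the sum, so only the boundedness of g(y)/x^(1/k) matters.
This ratio need not converge along real x, for instance when g takes only powers of q as values. -/
theorem tendsto_sum_character_sub [Countable P] {k : ℕ} (hk : 1 ≤ k) (ξ : ℝ) (b : FreeMon P) :
    Tendsto (fun x : ℝ => ∑ a ∈ D.ball ((x / normM N b) ^ (1 / (k : ℝ))),
      (D.character ξ x a - Complex.exp (-(ξ ^ 2 / 2 : ℝ))) / (x ^ (1 / (k : ℝ)) : ℝ)) atTop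
      (𝓝 0) := by
  have hk0 : (0 : ℝ) < k := by exact_mod_cast hk
  have hn := D.one_le_norm b
  have hκ := D.κ_pos
  set e₀ : ℂ := Complex.exp (-(ξ ^ 2 / 2 : ℝ)) with he₀
  set y : ℝ → ℝ := fun x => (x / normM N b) ^ (1 / (k : ℝ)) with hy
  have hy1 : ∀ᶠ x in atTop, 1 ≤ y x :=
    (tendsto_root_atTop hk (by linarith : (0 : ℝ) < normM N b)).eventually_ge_atTop 1
  set Φ : ℝ → ℂ := fun x => Complex.exp (-(Complex.I * (ξ * √(loglog x) : ℝ))) with hΦ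
  have hΦn : ∀ x, ‖Φ x‖ = 1 := fun x => by
    simp only [hΦ]
    rw [← mul_neg, mul_comm, ← Complex.ofReal_neg, Complex.norm_exp_ofReal_mul_I]
  set M : ℝ → ℂ := fun x => ∏ p ∈ D.primes (cutoff x), (1 + incr ξ x * (N p : ℂ)⁻¹) with hM
  -- the error in the sum
  have h1 : Tendsto (fun x => Φ x * (∑ a ∈ D.ball (y x), (1 + incr ξ x) ^ D.omegaLe (cutoff x) a -
      (D.κ * D.g (y x) : ℝ) * M x) / (x ^ (1 / (k : ℝ)) : ℝ)) atTop (𝓝 0) := by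
    have h2 := (tendsto_exp_mul_error (2 * Real.exp 1 * |ξ|) (c := (1 - D.θ) / k)
      (div_pos (sub_pos.2 D.θ_lt_one) hk0)).const_mul (2 * D.K)
    rw [mul_zero] at h2
    refine squeeze_zero_norm' ?_ h2
    filter_upwards [D.norm_sum_character_sub_le hk ξ b, eventually_ge_atTop 0] with x hx hx0
    rw [norm_div, norm_mul, hΦn, one_mul, Complex.norm_real, Real.norm_of_nonneg (by positivity)]
    exact hx
  -- the error in the main term
  have h3 : Tendsto (fun x => (D.κ * D.g (y x) / x ^ (1 / (k : ℝ)) : ℝ) * (Φ x * M x - e₀)) atTop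
      (𝓝 0) := by
    have h4 := ((D.tendsto_prod_incr ξ).sub_const e₀).norm.const_mul D.κ
    rw [sub_self, norm_zero, mul_zero] at h4
    refine squeeze_zero_norm' ?_ h4
    filter_upwards [hy1, eventually_gt_atTop 0] with x hx hx0
    rw [norm_mul, Complex.norm_real]
    gcongr
    have h5 := D.g_pos hx
    have h6 := D.g_le _ hx
    have h7 : y x ≤ x ^ (1 / (k : ℝ)) := root_le hx0.le hn
    rw [Real.norm_of_nonneg (by positivity), div_le_iff₀ (by positivity)]
    gcongr
    linarith
  -- the error in the count
  have h8 : Tendsto (fun x => e₀ * (((D.κ * D.g (y x) - (D.ball (y x)).card) /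
      x ^ (1 / (k : ℝ)) : ℝ) : ℂ)) atTop (𝓝 0) := by
    have h9 : Tendsto (fun x : ℝ => ‖e₀‖ * (D.C * x ^ (-((1 - D.θ) / k)))) atTop (𝓝 0) := by
      have := ((tendsto_rpow_neg_atTop (div_pos (sub_pos.2 D.θ_lt_one) hk0)).const_mul
        D.C).const_mul ‖e₀‖
      simpa using this
    refine squeeze_zero_norm' ?_ h9
    filter_upwards [hy1, eventually_gt_atTop 0] with x hx hx0
    rw [norm_mul, Complex.norm_real, norm_div,
      Real.norm_of_nonneg (r := x ^ (1 / (k : ℝ))) (by positivity)]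
    gcongr
    rw [div_le_iff₀ (by positivity), norm_sub_rev]
    refine (D.card_ball hx).trans ?_
    have h7 : y x ≤ x ^ (1 / (k : ℝ)) := root_le hx0.le hn
    have hC := D.C_nonneg
    have hθ := D.θ_nonneg
    rw [mul_assoc, ← Real.rpow_add hx0]
    gcongr
    calc (y x) ^ D.θ ≤ (x ^ (1 / (k : ℝ))) ^ D.θ := by gcongr
      _ = _ := by
        rw [← Real.rpow_mul hx0.le]
        congr 1
        ring
  have h := (h1.add h3).add h8
  simp only [add_zero] at h
  refine h.congr' ?_
  filter_upwards [tendsto_loglog.eventually_gt_atTop 0] with x hL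
  rw [← Finset.sum_div, Finset.sum_sub_distrib, Finset.sum_const, nsmul_eq_mul]
  simp_rw [D.character_eq hL]
  rw [← Finset.mul_sum]
  push_cast
  simp only [hΦ, hy]
  push_cast
  ring

/-- Dominated convergence over b with majorant 2K N(b)^(-1/k). As the limit has been subtracted,
passing from x^(1/k) to the true count needs only the lower bound for that count. -/
theorem tendsto_sum_fullBall_character [Countable P] {k : ℕ} (hk : 1 ≤ k) (ξ : ℝ) :
    Tendsto (fun x : ℝ => (∑ m ∈ D.fullBall k x, D.character ξ x (quotPart k m)) /
      ((D.fullBall k x).card : ℂ)) atTop (𝓝 (Complex.exp (-(ξ ^ 2 / 2 : ℝ)))) := by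
  classical
  set e₀ : ℂ := Complex.exp (-(ξ ^ 2 / 2 : ℝ)) with he₀
  have he₀n : ‖e₀‖ ≤ 1 := by
    rw [he₀, ← Complex.ofReal_neg, Complex.norm_exp, Complex.ofReal_re, Real.exp_le_one_iff]
    have := sq_nonneg ξ
    linarith
  have hK := D.K_pos
  have h1 : Tendsto (fun x : ℝ => ∑ m ∈ D.fullBall k x,
      (D.character ξ x (quotPart k m) - e₀) / (x ^ (1 / (k : ℝ)) : ℝ)) atTop (𝓝 0) := by
    have h2 := tendsto_tsum_of_dominated_convergence (𝓕 := atTop)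
      (f := fun (x : ℝ) (b : FreeMon P) => if b ∈ residual P k then
        ∑ a ∈ D.ball ((x / normM N b) ^ (1 / (k : ℝ))),
          (D.character ξ x a - e₀) / (x ^ (1 / (k : ℝ)) : ℝ) else 0)
      (g := fun _ => (0 : ℂ)) ((D.summable_residual hk).mul_left (2 * D.K)) (fun b => ?_) ?_
    · rw [tsum_zero] at h2
      refine h2.congr' ?_
      filter_upwards [eventually_ge_atTop 0] with x hx
      exact (D.sum_fullBall_eq_tsum hk hx
        fun a => (D.character ξ x a - e₀) / (x ^ (1 / (k : ℝ)) : ℝ)).symm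
    · split_ifs with hb
      · exact D.tendsto_sum_character_sub hk ξ b
      · exact tendsto_const_nhds
    · filter_upwards [eventually_gt_atTop 0] with x hx b
      split_ifs with hb
      · have h3 : ∀ a ∈ D.ball ((x / normM N b) ^ (1 / (k : ℝ))),
            ‖(D.character ξ x a - e₀) / (x ^ (1 / (k : ℝ)) : ℝ)‖ ≤ 2 / x ^ (1 / (k : ℝ)) := by
          intro a _
          rw [norm_div, Complex.norm_real, Real.norm_of_nonneg (by positivity)]
          gcongr
          refine (norm_sub_le _ _).trans ?_
          rw [norm_character]
          linarith
        refine (norm_sum_le_of_le _ h3).trans ?_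
        rw [Finset.sum_const, nsmul_eq_mul]
        have h4 := D.card_ball_le (y := (x / normM N b) ^ (1 / (k : ℝ))) (by positivity)
        rw [div_rpow_root hx.le] at h4 ⊢
        calc _ ≤ D.K * (x ^ (1 / (k : ℝ)) * (normM N b : ℝ) ^ (-(1 / (k : ℝ)))) *
              (2 / x ^ (1 / (k : ℝ))) := by gcongr
          _ = _ := by
            have : x ^ (1 / (k : ℝ)) ≠ 0 := by positivity
            field_simp
      · simp
  obtain ⟨c, hc, hcard⟩ := D.exists_le_card_fullBall hk
  have h5 : Tendsto (fun x : ℝ => ((x ^ (1 / (k : ℝ)) / (D.fullBall k x).card : ℝ) : ℂ) *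
      ∑ m ∈ D.fullBall k x,
        (D.character ξ x (quotPart k m) - e₀) / (x ^ (1 / (k : ℝ)) : ℝ)) atTop (𝓝 0) := by
    have h6 := h1.norm.const_mul c⁻¹
    rw [norm_zero, mul_zero] at h6
    refine squeeze_zero_norm' ?_ h6
    filter_upwards [eventually_ge_atTop 1] with x hx
    have h7 := hcard x hx
    have h8 : 0 < x ^ (1 / (k : ℝ)) := by positivity
    have h9 : (0 : ℝ) < (D.fullBall k x).card := lt_of_lt_of_le (by positivity) h7
    rw [norm_mul, Complex.norm_real, Real.norm_of_nonneg (by positivity)]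
    gcongr
    rw [div_le_iff₀ h9, ← div_eq_inv_mul, le_div_iff₀ hc, mul_comm]
    exact h7
  have h10 := h5.add_const e₀
  rw [zero_add] at h10
  refine h10.congr' ?_
  filter_upwards [eventually_ge_atTop 1] with x hx
  have h7 := hcard x hx
  have h8 : 0 < x ^ (1 / (k : ℝ)) := by positivity
  have h9 : (0 : ℝ) < (D.fullBall k x).card := lt_of_lt_of_le (by positivity) h7
  have h9' : ((D.fullBall k x).card : ℂ) ≠ 0 := by exact_mod_cast h9.ne'
  have h8' : ((x ^ (1 / (k : ℝ)) : ℝ) : ℂ) ≠ 0 := by exact_mod_cast h8.ne'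
  rw [← Finset.sum_div, Finset.sum_sub_distrib, Finset.sum_const, nsmul_eq_mul]
  rw [Complex.ofReal_div, Complex.ofReal_natCast]
  field_simp
  ring

end RegularNorm

/-! ### From characteristic functions to distribution functions -/

open MeasureTheory ProbabilityTheory

theorem ofReal_Phi (t : ℝ) : gaussianReal 0 1 (Set.Iic t) = ENNReal.ofReal (Phi t) := by
  rw [gaussianReal_apply_eq_integral _ one_ne_zero, gaussianPDFReal_def, Phi, integral_const_mul]
  simp

theorem Phi_nonneg (t : ℝ) : 0 ≤ Phi t :=
  mul_nonneg (by positivity) (integral_nonneg fun u => (Real.exp_pos _).le)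

theorem continuous_Phi : Continuous Phi := by
  have hint : Integrable fun u : ℝ => Real.exp (-u ^ 2 / 2) := by
    refine (integrable_exp_neg_mul_sq (b := 1 / 2) (by norm_num)).congr
      (Eventually.of_forall fun u => ?_)
    simp only
    ring_nf
  have h1 : Phi = fun t => 1 / √(2 * Real.pi) * ((∫ u in Set.Iic 0, Real.exp (-u ^ 2 / 2)) +
      ∫ u in (0 : ℝ)..t, Real.exp (-u ^ 2 / 2)) := by
    funext t
    rw [← intervalIntegral.integral_Iic_sub_Iic hint.integrableOn hint.integrableOn,
      add_sub_cancel, Phi]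
  rw [h1]
  exact continuous_const.mul (continuous_const.add
    (intervalIntegral.continuous_primitive (fun a b => hint.intervalIntegrable) 0))

/-- The distribution of a function under the uniform measure on a finite set. -/
def empirical {α : Type*} (T : Finset α) (V : α → ℝ) : Measure ℝ :=
  (T.card : ENNReal)⁻¹ • ∑ m ∈ T, Measure.dirac (V m)

theorem isProbabilityMeasure_empirical {α : Type*} {T : Finset α} (hT : T.Nonempty) (V : α → ℝ) :
    IsProbabilityMeasure (empirical T V) := by
  refine ⟨?_⟩
  rw [empirical, Measure.smul_apply, Measure.finsetSum_apply]
  simp only [measure_univ, Finset.sum_const, nsmul_eq_mul, mul_one, smul_eq_mul]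
  exact ENNReal.inv_mul_cancel (by simpa using hT.ne_empty) (ENNReal.natCast_ne_top _)

theorem empirical_Iic {α : Type*} (T : Finset α) (V : α → ℝ) (t : ℝ) :
    (empirical T V (Set.Iic t)).toReal =
      ((T.filter fun m => V m ≤ t).card : ℝ) / (T.card : ℝ) := by
  have h1 : ∀ m, Measure.dirac (V m) (Set.Iic t) = if V m ≤ t then (1 : ENNReal) else 0 := by
    intro m
    rw [Measure.dirac_apply' _ measurableSet_Iic]
    simp [Set.indicator_apply]
  rw [empirical, Measure.smul_apply, Measure.finsetSum_apply]
  simp only [h1, smul_eq_mul, Finset.sum_boole, ENNReal.toReal_mul, ENNReal.toReal_inv,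
    ENNReal.toReal_natCast]
  rw [div_eq_inv_mul]

theorem charFun_empirical {α : Type*} (T : Finset α) (V : α → ℝ) (ξ : ℝ) :
    charFun (empirical T V) ξ =
      (∑ m ∈ T, Complex.exp (Complex.I * (ξ * V m : ℝ))) / (T.card : ℂ) := by
  rw [charFun_apply_real, empirical, integral_smul_measure, integral_finsetSum_measure]
  · simp only [integral_dirac, ENNReal.toReal_inv, ENNReal.toReal_natCast]
    rw [Complex.real_smul, div_eq_inv_mul]
    push_cast
    congr 1
    refine Finset.sum_congr rfl fun m _ => ?_
    ring_nf
  · intro m _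
    exact integrable_dirac (by simp)

/-- Lévy's continuity theorem along sequences, then the portmanteau theorem: a half-line has a
single boundary point, which the Gaussian does not charge. -/
theorem tendsto_card_filter_le {α : Type*} {T : ℝ → Finset α} {V : ℝ → α → ℝ}
    (hT : ∀ᶠ x in atTop, (T x).Nonempty)
    (h : ∀ ξ : ℝ, Tendsto (fun x => (∑ m ∈ T x, Complex.exp (Complex.I * (ξ * V x m : ℝ))) /
      ((T x).card : ℂ)) atTop (𝓝 (Complex.exp (-(ξ ^ 2 / 2 : ℝ))))) (t : ℝ) :
    Tendsto (fun x => (((T x).filter fun m => V x m ≤ t).card : ℝ) / ((T x).card : ℝ)) atTop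
      (𝓝 (Phi t)) := by
  classical
  refine tendsto_of_seq_tendsto fun u hu => ?_
  -- Where the set is empty a Dirac mass stands in; this does not affect the limit.
  have hex : ∀ n, ∃ ν : ProbabilityMeasure ℝ,
      (T (u n)).Nonempty → (ν : Measure ℝ) = empirical (T (u n)) (V (u n)) := by
    intro n
    by_cases hn : (T (u n)).Nonempty
    · exact ⟨⟨empirical (T (u n)) (V (u n)), isProbabilityMeasure_empirical hn _⟩, fun _ => rfl⟩
    · exact ⟨⟨Measure.dirac 0, inferInstance⟩, fun h => absurd h hn⟩
  choose μ hμn using hex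
  have hev := hu.eventually hT
  set γ : ProbabilityMeasure ℝ := ⟨gaussianReal 0 1, inferInstance⟩ with hγ
  have hlim : Tendsto μ atTop (𝓝 γ) := by
    refine ProbabilityMeasure.tendsto_of_tendsto_charFun fun ξ => ?_
    have h1 : charFun (γ : Measure ℝ) ξ = Complex.exp (-(ξ ^ 2 / 2 : ℝ)) := by
      rw [hγ, ProbabilityMeasure.coe_mk, charFun_gaussianReal]
      congr 1
      push_cast
      ring
    rw [h1]
    refine ((h ξ).comp hu).congr' ?_
    filter_upwards [hev] with n hn
    rw [hμn n hn, charFun_empirical, Function.comp_apply]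
  have h2 := ProbabilityMeasure.tendsto_measure_of_null_frontier_of_tendsto' hlim
    (E := Set.Iic t) (by
      have := nullSingletonClass_gaussianReal (μ := 0) (v := 1) one_ne_zero
      simp [hγ])
  have h3 : (γ : Measure ℝ) (Set.Iic t) = ENNReal.ofReal (Phi t) := ofReal_Phi t
  rw [h3] at h2
  have h4 := (ENNReal.tendsto_toReal ENNReal.ofReal_ne_top).comp h2
  rw [ENNReal.toReal_ofReal (Phi_nonneg t)] at h4
  refine h4.congr' ?_
  filter_upwards [hev] with n hn
  simp only [Function.comp_apply]
  rw [hμn n hn, empirical_Iic]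

/-! ### Comparison of ω_𝒜 with the truncated count -/

theorem omegaSeq_eq_sum (a : ℕ → ℂ) (m : FreeMon P) :
    omegaSeq a m = ∑ p ∈ m.support, a (m p) := by
  classical
  have h1 : omegaSeq a m = ∑ i ∈ m.support.image m, a i * (omega i m : ℂ) := by
    refine finsum_mem_eq_sum_of_inter_support_eq (s := {i : ℕ | 1 ≤ i})
      (fun i => a i * (omega i m : ℂ)) ?_
    ext i
    simp only [Set.mem_inter_iff, Set.mem_ofPred_eq, Function.mem_support, Finset.coe_image,
      Set.mem_image, Finset.mem_coe, and_congr_left_iff]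
    intro hi
    have h2 : omega i m ≠ 0 := fun h => hi (by rw [h]; simp)
    obtain ⟨p, hp⟩ := Finset.card_pos.1 (Nat.pos_of_ne_zero h2)
    obtain ⟨hp1, rfl⟩ := Finset.mem_filter.1 hp
    exact ⟨fun _ => ⟨p, hp1, rfl⟩,
      fun _ => Nat.one_le_iff_ne_zero.2 (Finsupp.mem_support_iff.1 hp1)⟩
  rw [h1, ← Finset.sum_fiberwise_of_maps_to (g := m) (t := m.support.image m)
    fun p hp => Finset.mem_image_of_mem _ hp]
  refine Finset.sum_congr rfl fun i _ => ?_
  rw [Finset.sum_congr rfl fun p hp => by rw [(Finset.mem_filter.1 hp).2], Finset.sum_const,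
    nsmul_eq_mul, mul_comm]
  rfl

namespace RegularNorm

variable (D : RegularNorm N)

open Classical in
theorem omegaLe_quotPart (k : ℕ) (w : ℝ) (m : FreeMon P) :
    (D.omegaLe w (quotPart k m) : ℂ) =
      ∑ p ∈ m.support, if (N p : ℝ) ≤ w ∧ quotDigit k (m p) ≠ 0 then 1 else 0 := by
  rw [Finset.sum_boole, omegaLe]
  congr 2
  ext p
  simp only [Finset.mem_inter, D.mem_primes, Finset.mem_filter, Finsupp.mem_support_iff, quotPart,
    Finsupp.mapRange_apply]
  refine ⟨fun h => ⟨fun h0 => h.2 ?_, h⟩, fun h => h.2⟩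
  rw [h0]
  simp [quotDigit]

/-- The difference of `ω_𝒜 / a_k` and the truncated number of prime divisors. -/
def deviation (a : ℕ → ℂ) (k : ℕ) (x : ℝ) (m : FreeMon P) : ℂ :=
  1 / a k * omegaSeq a m - (D.omegaLe (cutoff x) (quotPart k m) : ℂ)

/-- A prime of multiplicity exactly k has digit 1 and coefficient 1, so it cancels unless it lies
above the cutoff. For larger multiplicities nothing is cancelled; the summand 1 in `hM` covers a
possible occurrence in a. -/
theorem norm_deviation_le {a : ℕ → ℂ} {k : ℕ} (hk : 1 ≤ k) (hak : a k ≠ 0) {M β : ℝ}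
    (hM : ∀ l, ‖1 / a k * a l‖ + 1 ≤ M * β ^ l) {x : ℝ} {m : FreeMon P}
    (hm : m ∈ D.fullBall k x) :
    ‖D.deviation a k x m‖ ≤ ∑ p ∈ m.support,
      ((if m p = k ∧ cutoff x < N p ∧ (N p : ℝ) ≤ x then 1 else 0) +
        if k < m p then M * β ^ m p else 0) := by
  classical
  obtain ⟨hmx, hmf⟩ := D.mem_fullBall.1 hm
  rw [deviation, omegaSeq_eq_sum, omegaLe_quotPart, Finset.mul_sum, ← Finset.sum_sub_distrib]
  refine norm_sum_le_of_le _ fun p hp => ?_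
  have hpx : (N p : ℝ) ≤ x := by
    have h1 := le_normM D.one_lt m p
    have h2 : N p ≤ N p ^ m p := Nat.le_self_pow (Finsupp.mem_support_iff.1 hp) _
    have h3 : (N p : ℝ) ≤ normM N m := by exact_mod_cast h2.trans h1
    linarith
  rcases (hmf p hp).eq_or_lt with h | h
  · have hq : quotDigit k k = 1 := by
      rw [quotDigit, if_pos dvd_rfl, Nat.div_self hk]
    rw [← h, hq, one_div_mul_cancel hak]
    by_cases hw : (N p : ℝ) ≤ cutoff x
    · simp [hw, not_lt.2 hw]
    · simp [hw, not_le.1 hw, hpx]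
  · have h1 : (0 : ℝ) ≤ if m p = k ∧ cutoff x < N p ∧ (N p : ℝ) ≤ x then 1 else 0 := by
      split_ifs <;> simp
    rw [if_pos h]
    refine le_trans ((norm_sub_le _ _).trans (add_le_add le_rfl ?_))
      ((hM (m p)).trans (le_add_of_nonneg_left h1))
    split_ifs <;> simp

/-- In the first moment bound, multiplicity k gives the sum of 1/N(p) between the cutoff and x,
which is o(√L), and higher multiplicities give a bounded amount. -/
theorem tendsto_sum_norm_deviation [Countable P] {a : ℕ → ℂ} {k : ℕ} (hk : 1 ≤ k) (hak : a k ≠ 0)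
    {M β : ℝ} (hM : ∀ l, ‖1 / a k * a l‖ + 1 ≤ M * β ^ l) (hβ0 : 0 < β)
    (hβ : β < 2 ^ (1 / (k : ℝ))) :
    Tendsto (fun x => (∑ m ∈ D.fullBall k x, ‖D.deviation a k x m‖) /
      ((D.fullBall k x).card * √(loglog x))) atTop (𝓝 0) := by
  classical
  have hk0 : (0 : ℝ) < k := by exact_mod_cast hk
  have hM0 : 0 ≤ M := by
    have h1 := hM 0
    rw [pow_zero, mul_one] at h1
    exact le_trans (by positivity) h1
  obtain ⟨C, hC, hup⟩ := D.exists_card_fullBall_le hk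
  obtain ⟨c, hc, hlow⟩ := D.exists_le_card_fullBall hk
  -- Every N(p) is at least 2, so ρ < 1 bounds the ratios β N(p)^(-1/k) of the geometric series over
  -- l for all p at once. This is where the growth condition on the coefficients enters.
  set ρ : ℝ := β * 2 ^ (-(1 / (k : ℝ))) with hρ
  have hρ1 : ρ < 1 := by
    rw [hρ, Real.rpow_neg two_pos.le, ← div_eq_mul_inv]
    exact (div_lt_one (by positivity)).2 hβ
  set H : ℝ := M * (β ^ (k + 1) / (1 - ρ)) * D.primeSum (1 / k) with hH
  -- the bound for the weighted prime sums
  have hbound : ∀ x, cutoff x ≤ x → ∑ m ∈ D.fullBall k x, ‖D.deviation a k x m‖ ≤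
      C * x ^ (1 / (k : ℝ)) * ((D.invSum x - D.invSum (cutoff x)) + H) := by
    intro x hx
    have hx0 : 0 ≤ x := (Real.exp_pos _).le.trans hx
    refine (Finset.sum_le_sum fun m hm => D.norm_deviation_le hk hak hM hm).trans ?_
    refine D.sum_fullBall_sum_support_le hup (fun p l =>
      (if l = k ∧ cutoff x < N p ∧ (N p : ℝ) ≤ x then 1 else 0) +
        if k < l then M * β ^ l else 0) (fun p l => ?_) _ (fun F L => ?_) hx0
    · split_ifs <;> positivity
    · have hr : ∀ p : P, β * (N p : ℝ) ^ (-(1 / (k : ℝ))) ≤ ρ := fun p => by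
        rw [hρ]
        gcongr ?_ * ?_
        exact Real.rpow_le_rpow_of_nonpos two_pos (D.two_le p) (by simp)
      have hterm : ∀ p ∈ F, ∑ l ∈ Finset.Ico 1 L,
          ((if l = k ∧ cutoff x < N p ∧ (N p : ℝ) ≤ x then (1 : ℝ) else 0) +
            if k < l then M * β ^ l else 0) * ((N p : ℝ) ^ (-(1 / (k : ℝ)))) ^ l ≤
          (if p ∈ D.primes x \ D.primes (cutoff x) then (N p : ℝ)⁻¹ else 0) +
            M * (β ^ (k + 1) / (1 - ρ)) * (N p : ℝ) ^ (-(1 + 1 / (k : ℝ))) := by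
        intro p _
        simp_rw [add_mul]
        rw [Finset.sum_add_distrib]
        refine add_le_add ?_ ?_
        · by_cases hp : cutoff x < N p ∧ (N p : ℝ) ≤ x
          · rw [if_pos (by simpa [D.mem_primes, and_comm] using hp)]
            simp only [hp, and_true, ite_mul, one_mul, zero_mul]
            rw [Finset.sum_ite_eq']
            split_ifs
            · rw [← Real.rpow_mul_natCast (by positivity), neg_mul, one_div_mul_cancel hk0.ne',
                Real.rpow_neg_one]
            · positivity
          · rw [if_neg (by simpa [D.mem_primes, and_comm] using hp)]
            simp only [hp, and_false, if_false, zero_mul, Finset.sum_const_zero, le_refl]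
        · set r := β * (N p : ℝ) ^ (-(1 / (k : ℝ))) with hrdef
          have hr0 : 0 ≤ r := by positivity
          have hr1 : r < 1 := (hr p).trans_lt hρ1
          have h1 : ∑ l ∈ Finset.Ico 1 L, (if k < l then M * β ^ l else 0) *
              ((N p : ℝ) ^ (-(1 / (k : ℝ)))) ^ l ≤ ∑ l ∈ Finset.Ico (k + 1) L, M * r ^ l := by
            simp only [ite_mul, zero_mul]
            rw [← Finset.sum_filter]
            have h2 : ∀ l, M * β ^ l * ((N p : ℝ) ^ (-(1 / (k : ℝ)))) ^ l = M * r ^ l := fun l => by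
              rw [hrdef, mul_pow, mul_assoc]
            simp_rw [h2]
            refine Finset.sum_le_sum_of_subset_of_nonneg (fun l hl => ?_) fun _ _ _ => by positivity
            obtain ⟨h3, h4⟩ := Finset.mem_filter.1 hl
            exact Finset.mem_Ico.2 ⟨h4, (Finset.mem_Ico.1 h3).2⟩
          refine h1.trans ?_
          rw [← Finset.mul_sum]
          have h5 : r ^ (k + 1) = β ^ (k + 1) * (N p : ℝ) ^ (-(1 + 1 / (k : ℝ))) := by
            rw [hrdef, mul_pow, ← Real.rpow_mul_natCast (by positivity)]
            congr 2
            push_cast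
            field_simp
          calc M * ∑ l ∈ Finset.Ico (k + 1) L, r ^ l
              ≤ M * (r ^ (k + 1) / (1 - r)) := by
                gcongr
                exact geom_sum_Ico_le_of_lt_one hr0 hr1
            _ ≤ M * (r ^ (k + 1) / (1 - ρ)) := by
                gcongr
                exact hr p
            _ = _ := by
                rw [h5]
                ring
      refine (Finset.sum_le_sum hterm).trans ?_
      rw [Finset.sum_add_distrib]
      refine add_le_add ?_ ?_
      · have hsub : D.primes (cutoff x) ⊆ D.primes x := fun p hp =>
          D.mem_primes.2 ((D.mem_primes.1 hp).trans hx)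
        rw [invSum, invSum, ← Finset.sum_sdiff hsub, add_sub_cancel_right, ← Finset.sum_filter]
        exact Finset.sum_le_sum_of_subset_of_nonneg (fun p hp => (Finset.mem_filter.1 hp).2)
          fun _ _ _ => by positivity
      · rw [← Finset.mul_sum, hH]
        have h1 : 0 < 1 - ρ := by linarith
        gcongr
        exact (D.summable_prime (by positivity)).sum_le_tsum _ fun p _ => by positivity
  have hlim : Tendsto (fun x => C / c * (((D.invSum x - loglog x) / √(loglog x) -
      (D.invSum (cutoff x) - loglog x) / √(loglog x)) + H / √(loglog x))) atTop (𝓝 0) := by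
    have := ((D.tendsto_invSum_sub.sub D.tendsto_invSum_cutoff_sub).add
      (tendsto_const_div_sqrt_loglog H)).const_mul (C / c)
    simpa using this
  refine squeeze_zero' (Eventually.of_forall fun x => by positivity) ?_ hlim
  filter_upwards [eventually_ge_atTop 1, tendsto_loglog.eventually_ge_atTop 1,
    Real.tendsto_log_atTop.eventually_gt_atTop 0] with x hx hL hX
  have hcut : cutoff x ≤ x := by
    rw [cutoff, ← Real.le_log_iff_exp_le (by linarith)]
    exact div_le_self hX.le (one_le_pow₀ hL)
  have hs0 : 0 < √(loglog x) := Real.sqrt_pos.2 (by linarith)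
  have hxk : 0 < x ^ (1 / (k : ℝ)) := by positivity
  have h1 := hbound x hcut
  have h2 := hlow x hx
  calc (∑ m ∈ D.fullBall k x, ‖D.deviation a k x m‖) / ((D.fullBall k x).card * √(loglog x))
      ≤ (∑ m ∈ D.fullBall k x, ‖D.deviation a k x m‖) /
          (c * x ^ (1 / (k : ℝ)) * √(loglog x)) := by gcongr
    _ ≤ (C * x ^ (1 / (k : ℝ)) * ((D.invSum x - D.invSum (cutoff x)) + H)) /
          (c * x ^ (1 / (k : ℝ)) * √(loglog x)) := by gcongr
    _ = _ := by
        field_simp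
        ring

end RegularNorm

/-! ### Transfer to the normalized function -/

namespace RegularNorm

variable (D : RegularNorm N)

theorem eventually_card_fullBall_pos {k : ℕ} (hk : 1 ≤ k) :
    ∀ᶠ x in atTop, (D.fullBall k x).Nonempty := by
  obtain ⟨c, hc, h⟩ := D.exists_le_card_fullBall hk
  filter_upwards [eventually_ge_atTop 1] with x hx
  have h1 := h x hx
  have h2 : 0 < c * x ^ (1 / (k : ℝ)) := by positivity
  exact Finset.card_pos.1 (by exact_mod_cast h2.trans_le h1)

/-- The normalized truncated number of prime divisors. -/
def truncated (k : ℕ) (x : ℝ) (m : FreeMon P) : ℝ :=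
  (D.omegaLe (cutoff x) (quotPart k m) - loglog x) / √(loglog x)

theorem tendsto_card_truncated_le [Countable P] {k : ℕ} (hk : 1 ≤ k) (t : ℝ) :
    Tendsto (fun x => (((D.fullBall k x).filter fun m => D.truncated k x m ≤ t).card : ℝ) /
      ((D.fullBall k x).card : ℝ)) atTop (𝓝 (Phi t)) :=
  tendsto_card_filter_le (D.eventually_card_fullBall_pos hk)
    (fun ξ => D.tendsto_sum_fullBall_character hk ξ) t

/-- The elements of small norm or of large deviation. -/
def exceptional (a : ℕ → ℂ) (k : ℕ) (η x : ℝ) : Finset (FreeMon P) :=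
  (D.fullBall k x).filter fun m =>
    (normM N m : ℝ) ≤ √x ∨ η * √(loglog x) < ‖D.deviation a k x m‖

/-- Norms up to √x account for a proportion O(x^(-1/(2k))), and large deviations are rare by
Markov's inequality. -/
theorem tendsto_card_exceptional [Countable P] {a : ℕ → ℂ} {k : ℕ} (hk : 1 ≤ k)
    (hdev : Tendsto (fun x => (∑ m ∈ D.fullBall k x, ‖D.deviation a k x m‖) /
      ((D.fullBall k x).card * √(loglog x))) atTop (𝓝 0)) {η : ℝ} (hη : 0 < η) :
    Tendsto (fun x => ((D.exceptional a k η x).card : ℝ) / ((D.fullBall k x).card : ℝ)) atTop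
      (𝓝 0) := by
  classical
  have hk0 : (0 : ℝ) < k := by exact_mod_cast hk
  obtain ⟨C, hC, hup⟩ := D.exists_card_fullBall_le hk
  obtain ⟨c, hc, hlow⟩ := D.exists_le_card_fullBall hk
  have h1 : Tendsto (fun x : ℝ => C / c * x ^ (-(1 / (2 * k : ℝ))) +
      η⁻¹ * ((∑ m ∈ D.fullBall k x, ‖D.deviation a k x m‖) /
      ((D.fullBall k x).card * √(loglog x)))) atTop (𝓝 0) := by
    have := ((tendsto_rpow_neg_atTop (y := 1 / (2 * k : ℝ)) (by positivity)).const_mul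
      (C / c)).add (hdev.const_mul η⁻¹)
    simpa using this
  refine squeeze_zero' (Eventually.of_forall fun x => by positivity) ?_ h1
  filter_upwards [eventually_ge_atTop 1, tendsto_loglog.eventually_gt_atTop 0] with x hx hL
  have hs0 : 0 < √(loglog x) := Real.sqrt_pos.2 hL
  have hx0 : 0 < x := by linarith
  have hT0 : (0 : ℝ) < (D.fullBall k x).card := lt_of_lt_of_le (by positivity) (hlow x hx)
  have h2 : ((D.exceptional a k η x).card : ℝ) ≤ ((D.fullBall k √x).card : ℝ) +
      (((D.fullBall k x).filter fun m => η * √(loglog x) < ‖D.deviation a k x m‖).card : ℝ) := by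
    have h3 : D.exceptional a k η x ⊆ D.fullBall k √x ∪
        (D.fullBall k x).filter fun m => η * √(loglog x) < ‖D.deviation a k x m‖ := by
      intro m hm
      obtain ⟨h4, h5⟩ := Finset.mem_filter.1 hm
      rcases h5 with h5 | h5
      · exact Finset.mem_union_left _ (D.mem_fullBall.2 ⟨h5, (D.mem_fullBall.1 h4).2⟩)
      · exact Finset.mem_union_right _ (Finset.mem_filter.2 ⟨h4, h5⟩)
    exact_mod_cast (Finset.card_le_card h3).trans (Finset.card_union_le _ _)
  have h6 : (((D.fullBall k x).filter
      fun m => η * √(loglog x) < ‖D.deviation a k x m‖).card : ℝ) * (η * √(loglog x)) ≤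
      ∑ m ∈ D.fullBall k x, ‖D.deviation a k x m‖ := by
    rw [← nsmul_eq_mul]
    refine (Finset.card_nsmul_le_sum _ _ _ fun m hm => (Finset.mem_filter.1 hm).2.le).trans ?_
    exact Finset.sum_le_sum_of_subset_of_nonneg (Finset.filter_subset _ _)
      fun _ _ _ => norm_nonneg _
  have h7 : ((D.fullBall k √x).card : ℝ) / (D.fullBall k x).card ≤
      C / c * x ^ (-(1 / (2 * k : ℝ))) := by
    rw [div_le_iff₀ hT0]
    refine (hup _ (Real.sqrt_nonneg x)).trans ?_
    calc C * √x ^ (1 / (k : ℝ)) = C / c * x ^ (-(1 / (2 * k : ℝ))) * (c * x ^ (1 / (k : ℝ))) := by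
          have h8 : √x ^ (1 / (k : ℝ)) = x ^ (-(1 / (2 * k : ℝ))) * x ^ (1 / (k : ℝ)) := by
            rw [Real.sqrt_eq_rpow, ← Real.rpow_mul hx0.le, ← Real.rpow_add hx0]
            congr 1
            field_simp
            ring
          rw [h8]
          field_simp
      _ ≤ _ := by
          gcongr
          exact hlow x hx
  refine (div_le_div_of_nonneg_right h2 hT0.le).trans ?_
  rw [add_div]
  refine add_le_add h7 ?_
  rw [div_le_iff₀ hT0]
  calc _ ≤ (∑ m ∈ D.fullBall k x, ‖D.deviation a k x m‖) / (η * √(loglog x)) := by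
        rwa [le_div_iff₀ (by positivity)]
    _ = _ := by field_simp

theorem loglog_norm_bounds {x : ℝ} {m : FreeMon P} (hX : 2 ≤ Real.log x) (hx : 0 < x)
    (h1 : √x < normM N m) (h2 : (normM N m : ℝ) ≤ x) :
    loglog x - 1 ≤ loglog (normM N m) ∧ loglog (normM N m) ≤ loglog x := by
  have hs : 0 < √x := Real.sqrt_pos.2 hx
  have h3 : Real.log x / 2 ≤ Real.log (normM N m) := by
    rw [← Real.log_sqrt hx.le]
    exact Real.log_le_log hs h1.le
  have h4 : Real.log (normM N m) ≤ Real.log x := Real.log_le_log (hs.trans h1) h2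
  constructor
  · have h5 := Real.log_le_log (by linarith) h3
    rw [Real.log_div (by linarith) two_ne_zero] at h5
    have := Real.log_two_lt_d9
    rw [loglog, loglog]
    linarith
  · exact Real.log_le_log (by linarith) h4

theorem re_normalized_le_iff {a : ℕ → ℂ} {k : ℕ} {m : FreeMon P} (hℓ : 0 < loglog (normM N m))
    (x t : ℝ) :
    (normalized N a k m).re ≤ t ↔
      D.omegaLe (cutoff x) (quotPart k m) + (D.deviation a k x m).re ≤
        loglog (normM N m) + t * √(loglog (normM N m)) := by
  have hs : 0 < √(loglog (normM N m)) := Real.sqrt_pos.2 hℓ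
  have h1 : (1 / a k * omegaSeq a m) =
      (D.omegaLe (cutoff x) (quotPart k m) : ℂ) + D.deviation a k x m := by
    rw [deviation]
    ring
  have h2 : (normalized N a k m).re = (D.omegaLe (cutoff x) (quotPart k m) +
      (D.deviation a k x m).re - loglog (normM N m)) / √(loglog (normM N m)) := by
    rw [normalized, h1]
    change (_ / ((√(loglog (normM N m)) : ℝ) : ℂ)).re = _
    rw [Complex.div_ofReal_re, Complex.sub_re, Complex.add_re, Complex.natCast_re,
      Complex.ofReal_re]
    rfl
  rw [h2, div_le_iff₀ hs]
  constructor <;> intro h <;> linarith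

theorem im_normalized {a : ℕ → ℂ} {k : ℕ} (x : ℝ) (m : FreeMon P) :
    (normalized N a k m).im = (D.deviation a k x m).im / √(loglog (normM N m)) := by
  have h1 : (1 / a k * omegaSeq a m) =
      (D.omegaLe (cutoff x) (quotPart k m) : ℂ) + D.deviation a k x m := by
    rw [deviation]
    ring
  rw [normalized, h1]
  change (_ / ((√(loglog (normM N m)) : ℝ) : ℂ)).im = _
  rw [Complex.div_ofReal_im, Complex.sub_im, Complex.add_im, Complex.natCast_im, Complex.ofReal_im]
  ring

theorem abs_sqrt_sub_le {u v : ℝ} (hv : v ≤ u) (hu : u - 1 ≤ v) (hu1 : 1 ≤ u) :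
    √u - 1 ≤ √v ∧ √v ≤ √u := by
  refine ⟨?_, Real.sqrt_le_sqrt hv⟩
  rw [sub_le_iff_le_add, Real.sqrt_le_left (by positivity)]
  have h1 := Real.sq_sqrt (show 0 ≤ v by linarith)
  nlinarith [Real.sqrt_nonneg v]

/-- The limit law along real values of the variable. -/
theorem tendsto_card_re_normalized_le [Countable P] {a : ℕ → ℂ} {k : ℕ} (hk : 1 ≤ k)
    (hdev : Tendsto (fun x => (∑ m ∈ D.fullBall k x, ‖D.deviation a k x m‖) /
      ((D.fullBall k x).card * √(loglog x))) atTop (𝓝 0)) (t : ℝ) :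
    Tendsto (fun x => (((D.fullBall k x).filter
      fun m => 3 ≤ normM N m ∧ (normalized N a k m).re ≤ t).card : ℝ) /
      ((D.fullBall k x).card : ℝ)) atTop (𝓝 (Phi t)) := by
  classical
  rw [Metric.tendsto_nhds]
  intro ε hε
  obtain ⟨δ, hδ, hPhi⟩ := Metric.continuousAt_iff.1 (continuous_Phi.continuousAt (x := t))
    (ε / 3) (by positivity)
  -- One η pays for the deviation, another for replacing L by log log N(m). The latter costs at most
  -- 1 + |t|, which is below η√L for large x; and 2η < δ.
  set η := δ / 3 with hη
  have hη0 : 0 < η := by positivity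
  have hP1 := hPhi (x := t + 2 * η) (by
    rw [Real.dist_eq, add_sub_cancel_left, abs_of_pos (by positivity)]
    linarith)
  have hP2 := hPhi (x := t - 2 * η) (by
    rw [Real.dist_eq, sub_sub_cancel_left, abs_neg, abs_of_pos (by positivity)]
    linarith)
  have hE := (Metric.tendsto_nhds.1 (D.tendsto_card_exceptional hk hdev hη0)) (ε / 3) (by positivity)
  have hV1 := (Metric.tendsto_nhds.1 (D.tendsto_card_truncated_le hk (t + 2 * η))) (ε / 3)
    (by positivity)
  have hV2 := (Metric.tendsto_nhds.1 (D.tendsto_card_truncated_le hk (t - 2 * η))) (ε / 3)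
    (by positivity)
  filter_upwards [hE, hV1, hV2, tendsto_loglog.eventually_ge_atTop 2,
    tendsto_sqrt_loglog.eventually_ge_atTop ((1 + |t|) / η),
    Real.tendsto_log_atTop.eventually_ge_atTop 2, eventually_ge_atTop 9] with x hE hV1 hV2 hL hs hX hx
  set T := D.fullBall k x with hT
  set A := T.filter fun m => 3 ≤ normM N m ∧ (normalized N a k m).re ≤ t with hA
  set V₁ := T.filter fun m => D.truncated k x m ≤ t + 2 * η with hV₁
  set V₂ := T.filter fun m => D.truncated k x m ≤ t - 2 * η with hV₂
  set E := D.exceptional a k η x with hEdef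
  have hs0 : 0 < √(loglog x) := Real.sqrt_pos.2 (by linarith)
  rw [div_le_iff₀ hη0] at hs
  -- the facts about the elements outside the exceptional set
  have hgood : ∀ m ∈ T, m ∉ E → 3 ≤ normM N m ∧ 0 < loglog (normM N m) ∧
      loglog x - 1 ≤ loglog (normM N m) ∧ loglog (normM N m) ≤ loglog x ∧
      |(D.deviation a k x m).re| ≤ η * √(loglog x) := by
    intro m hm hmE
    have h1 : ¬ ((normM N m : ℝ) ≤ √x ∨ η * √(loglog x) < ‖D.deviation a k x m‖) := fun h =>
      hmE (Finset.mem_filter.2 ⟨hm, h⟩)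
    rw [not_or, not_le, not_lt] at h1
    obtain ⟨h2, h3⟩ := h1
    obtain ⟨h4, h5⟩ := loglog_norm_bounds hX (by linarith) h2 (D.mem_fullBall.1 hm).1
    refine ⟨?_, by linarith, h4, h5, (Complex.abs_re_le_norm _).trans h3⟩
    have h6 : (3 : ℝ) ≤ √x := Real.le_sqrt_of_sq_le (by linarith)
    exact_mod_cast h6.trans h2.le
  have hsub1 : A ⊆ V₁ ∪ E := by
    intro m hm
    obtain ⟨hmT, -, hmt⟩ := Finset.mem_filter.1 hm
    by_cases hmE : m ∈ E
    · exact Finset.mem_union_right _ hmE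
    · refine Finset.mem_union_left _ (Finset.mem_filter.2 ⟨hmT, ?_⟩)
      obtain ⟨-, hℓ, h1, h2, h3⟩ := hgood m hmT hmE
      rw [D.re_normalized_le_iff hℓ x] at hmt
      obtain ⟨h4, h5⟩ := abs_sqrt_sub_le h2 h1 (by linarith)
      rw [truncated, div_le_iff₀ hs0]
      have h6 := (abs_le.1 h3).1
      have h7 : t * √(loglog (normM N m)) ≤ t * √(loglog x) + |t| := by
        have h8 : |t| * (√(loglog x) - √(loglog (normM N m))) ≤ |t| * 1 := by
          gcongr
          linarith
        have h9 := mul_le_mul_of_nonneg_right (neg_abs_le t) (sub_nonneg.2 h5)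
        linarith
      linarith
  have hsub2 : V₂ ⊆ A ∪ E := by
    intro m hm
    obtain ⟨hmT, hmt⟩ := Finset.mem_filter.1 hm
    by_cases hmE : m ∈ E
    · exact Finset.mem_union_right _ hmE
    · obtain ⟨h0, hℓ, h1, h2, h3⟩ := hgood m hmT hmE
      refine Finset.mem_union_left _ (Finset.mem_filter.2 ⟨hmT, h0, ?_⟩)
      rw [D.re_normalized_le_iff hℓ x]
      obtain ⟨h4, h5⟩ := abs_sqrt_sub_le h2 h1 (by linarith)
      rw [truncated, div_le_iff₀ hs0] at hmt
      have h6 := (abs_le.1 h3).2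
      have h7 : t * √(loglog x) - |t| ≤ t * √(loglog (normM N m)) := by
        have h8 : |t| * (√(loglog x) - √(loglog (normM N m))) ≤ |t| * 1 := by
          gcongr
          linarith
        have h9 := mul_le_mul_of_nonneg_right (le_abs_self t) (sub_nonneg.2 h5)
        linarith
      linarith
  have hc1 : (A.card : ℝ) / T.card ≤ V₁.card / T.card + E.card / T.card := by
    rw [← add_div]
    gcongr
    exact_mod_cast (Finset.card_le_card hsub1).trans (Finset.card_union_le _ _)
  have hc2 : (V₂.card : ℝ) / T.card ≤ A.card / T.card + E.card / T.card := by
    rw [← add_div]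
    gcongr
    exact_mod_cast (Finset.card_le_card hsub2).trans (Finset.card_union_le _ _)
  rw [Real.dist_eq, abs_lt] at *
  rw [sub_zero] at hE
  constructor <;> linarith [hE.2, hV1.2, hV2.1, hP1.2, hP2.1]

/-- The imaginary part comes from the deviation alone. Outside the exceptional set for ε/2 it is at
most ε, because √(log log N(m)) ≥ √L - 1 ≥ √L/2. -/
theorem tendsto_card_lt_abs_im_normalized [Countable P] {a : ℕ → ℂ} {k : ℕ} (hk : 1 ≤ k)
    (hdev : Tendsto (fun x => (∑ m ∈ D.fullBall k x, ‖D.deviation a k x m‖) /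
      ((D.fullBall k x).card * √(loglog x))) atTop (𝓝 0)) {ε : ℝ} (hε : 0 < ε) :
    Tendsto (fun x => (((D.fullBall k x).filter
      fun m => 3 ≤ normM N m ∧ ε < |(normalized N a k m).im|).card : ℝ) /
      ((D.fullBall k x).card : ℝ)) atTop (𝓝 0) := by
  refine squeeze_zero' (Eventually.of_forall fun x => by positivity) ?_
    (D.tendsto_card_exceptional hk hdev (half_pos hε))
  filter_upwards [tendsto_loglog.eventually_ge_atTop 4,
    Real.tendsto_log_atTop.eventually_ge_atTop 2, eventually_gt_atTop 0] with x hL hX hx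
  gcongr
  intro m hm
  obtain ⟨hmT, -, hmε⟩ := Finset.mem_filter.1 hm
  refine Finset.mem_filter.2 ⟨hmT, ?_⟩
  by_contra! hcon
  obtain ⟨h1, h2⟩ := hcon
  obtain ⟨h4, h5⟩ := loglog_norm_bounds hX hx h1 (D.mem_fullBall.1 hmT).1
  obtain ⟨h6, -⟩ := abs_sqrt_sub_le h5 h4 (by linarith)
  have h7 : 2 ≤ √(loglog x) := Real.le_sqrt_of_sq_le (by linarith)
  have h8 : 0 < √(loglog (normM N m)) := by linarith
  rw [D.im_normalized x, abs_div, abs_of_pos h8, lt_div_iff₀ h8] at hmε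
  have h9 := (Complex.abs_im_le_norm _).trans h2
  nlinarith

end RegularNorm

/-! ### From the hypotheses to a regular norm -/

variable {X : Set ℚ}

theorem IsRange.exists_ge (hX : IsRange N X) (y : ℚ) : ∃ x ∈ X, y ≤ x := by
  rcases hX.2 with rfl | ⟨q, hq, rfl⟩
  · exact ⟨y, Set.mem_univ y, le_rfl⟩
  · obtain ⟨n, hn⟩ := pow_unbounded_of_one_lt y (show (1 : ℚ) < q by exact_mod_cast hq)
    exact ⟨(q : ℚ) ^ n, ⟨n, (zpow_natCast _ _).symm⟩, hn.le⟩

/-- For some large x in `X` the main term exceeds the error, so `Set.ncard` is positive there, which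
excludes its default value 0 on infinite sets. -/
theorem finite_of_linearGrowth (hX : IsRange N X) (h : LinearGrowth N X) (y : ℝ) :
    {m : FreeMon P | (normM N m : ℝ) ≤ y}.Finite := by
  obtain ⟨κ, θ, hκ, -, hθ1, hO⟩ := h
  obtain ⟨C, hC⟩ := hO.bound
  rw [toInfinity, eventually_inf_principal] at hC
  have hlim : Tendsto (fun u : ℝ => C * u ^ (-(1 - θ))) atTop (𝓝 0) := by
    simpa using (tendsto_rpow_neg_atTop (sub_pos.2 hθ1)).const_mul C
  have hcast : Tendsto (fun x : ℚ => (x : ℝ)) atTop atTop :=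
    tendsto_ratCast_atTop_iff.2 tendsto_id
  obtain ⟨x₀, hx₀⟩ := (((hcast.eventually (hlim.eventually_lt_const hκ)).and
    (hcast.eventually_ge_atTop (max 1 y))).and hC).exists_forall_of_atTop
  obtain ⟨x, hxX, hx⟩ := hX.exists_ge x₀
  obtain ⟨⟨h1, h2⟩, h3⟩ := hx₀ x hx
  have h3 := h3 hxX
  have hx1 : (1 : ℝ) ≤ x := (le_max_left _ _).trans h2
  have hx0 : (0 : ℝ) < x := by linarith
  have h4 : C * (x : ℝ) ^ θ < κ * x := by
    calc C * (x : ℝ) ^ θ = C * (x : ℝ) ^ (-(1 - θ)) * x := by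
          rw [mul_assoc, ← Real.rpow_add_one hx0.ne']
          ring_nf
      _ < κ * x := by gcongr
  rw [Real.norm_eq_abs, Real.norm_of_nonneg (by positivity)] at h3
  have h5 : 0 < (upTo N Set.univ x).ncard := by
    have h6 := (abs_le.1 h3).1
    have h7 : (0 : ℝ) < (upTo N Set.univ x).ncard := by linarith
    exact_mod_cast h7
  refine (Set.finite_of_ncard_pos h5).subset fun m hm => ⟨Set.mem_univ m, ?_⟩
  have h6 : (normM N m : ℝ) ≤ x := le_trans hm ((le_max_right _ _).trans h2)
  exact_mod_cast h6

theorem ncard_upTo_univ (hfin : ∀ y : ℝ, {m : FreeMon P | (normM N m : ℝ) ≤ y}.Finite) (x : ℚ) :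
    (upTo N Set.univ x).ncard = (hfin x).toFinset.card := by
  rw [← Set.ncard_eq_toFinset_card _ (hfin x)]
  congr 1
  ext m
  simp only [upTo, Set.mem_univ, true_and, Set.mem_ofPred_eq]
  norm_cast

/-- Between 1 and the threshold, count and main term are bounded while x^θ ≥ 1, so a larger constant
covers all x ≥ 1 in `X`. -/
theorem exists_count_le
    (hfin : ∀ y : ℝ, {m : FreeMon P | (normM N m : ℝ) ≤ y}.Finite) {κ θ : ℝ} (hκ : 0 < κ)
    (hθ : 0 ≤ θ)
    (hO : (fun x : ℚ => ((upTo N Set.univ x).ncard : ℝ) - κ * (x : ℝ))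
      =O[toInfinity X] fun x : ℚ => (x : ℝ) ^ θ) :
    ∃ C : ℝ, 0 ≤ C ∧ ∀ x : ℚ, x ∈ X → 1 ≤ x →
      |((hfin x).toFinset.card : ℝ) - κ * x| ≤ C * (x : ℝ) ^ θ := by
  obtain ⟨C, hC0, hC⟩ := hO.exists_nonneg
  have hC := hC.bound
  rw [toInfinity, eventually_inf_principal] at hC
  obtain ⟨x₀, hx₀⟩ := hC.exists_forall_of_atTop
  set A₀ : ℝ := ((hfin x₀).toFinset.card : ℝ) with hA₀
  refine ⟨C + (A₀ + κ * |(x₀ : ℝ)|), by positivity, fun x hxX hx1 => ?_⟩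
  have hx1' : (1 : ℝ) ≤ x := by exact_mod_cast hx1
  have hxθ : 1 ≤ (x : ℝ) ^ θ := Real.one_le_rpow hx1' hθ
  have hrest : 0 ≤ A₀ + κ * |(x₀ : ℝ)| := by positivity
  rcases le_total x₀ x with h | h
  · have h1 := hx₀ x h hxX
    rw [Real.norm_eq_abs, Real.norm_of_nonneg (by positivity), ncard_upTo_univ hfin] at h1
    refine h1.trans ?_
    gcongr
    linarith
  · have h' : (x : ℝ) ≤ x₀ := by exact_mod_cast h
    have h1 : ((hfin x).toFinset.card : ℝ) ≤ A₀ := by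
      have : (hfin x).toFinset.card ≤ (hfin x₀).toFinset.card := by
        refine Finset.card_le_card fun m hm => ?_
        rw [Set.Finite.mem_toFinset, Set.mem_ofPred_eq] at hm ⊢
        exact hm.trans h'
      rw [hA₀]
      exact_mod_cast this
    have h2 : κ * x ≤ κ * |(x₀ : ℝ)| := by
      gcongr
      exact h'.trans (le_abs_self _)
    have h3 : 0 ≤ κ * (x : ℝ) := by positivity
    have h4 : |((hfin x).toFinset.card : ℝ) - κ * x| ≤ A₀ + κ * |(x₀ : ℝ)| := by
      rw [abs_le]
      constructor <;> linarith [Nat.cast_nonneg (α := ℝ) (hfin x).toFinset.card,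
        Nat.cast_nonneg (α := ℝ) (hfin x₀).toFinset.card]
    nlinarith

theorem log_div_zpow {q : ℕ} (hq : 1 < q) (z : ℤ) {y : ℝ} (hy : 0 < y) :
    Int.log q (y / (q : ℝ) ^ z) = Int.log q y - z := by
  have hq0 : (0 : ℝ) < q := by positivity
  refine eq_of_forall_le_iff fun x => ?_
  rw [← Int.zpow_le_iff_le_log hq (by positivity), le_div_iff₀ (by positivity),
    ← zpow_add₀ hq0.ne', Int.zpow_le_iff_le_log hq hy]
  omega

theorem nonempty_regularNorm (hN : ∀ p, 1 < N p) (hX : IsRange N X) (h : LinearGrowth N X) :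
    Nonempty (RegularNorm N) := by
  have hfin := finite_of_linearGrowth hX h
  obtain ⟨κ, θ, hκ, hθ0, hθ1, hO⟩ := h
  obtain ⟨C, hC, hcount⟩ := exists_count_le hfin hκ hθ0 hO
  rcases hX.2 with rfl | ⟨q, hq, hXq⟩
  -- Norms are integers, so the count at y is the count at ⌊y⌋. The extra κ in the constant covers κ
  -- (y - ⌊y⌋) ≤ κ y^θ.
  · refine ⟨⟨hN, hfin, κ, C + κ, θ, 1, fun y => y, hκ, by positivity, hθ0, hθ1, one_pos,
      fun m y _ => rfl, fun y _ => le_rfl, fun y _ => (one_mul y).ge, fun y hy => ?_⟩⟩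
    have hy0 : 0 ≤ y := by linarith
    have hfl : (⌊y⌋₊ : ℝ) ≤ y := Nat.floor_le hy0
    have hfl1 : y < ⌊y⌋₊ + 1 := Nat.lt_floor_add_one y
    have h1 := hcount (⌊y⌋₊ : ℚ) (Set.mem_univ _) (by exact_mod_cast (Nat.one_le_floor_iff y).2 hy)
    have h2 : (hfin ((⌊y⌋₊ : ℚ) : ℝ)).toFinset = (hfin y).toFinset := by
      ext m
      rw [Set.Finite.mem_toFinset, Set.Finite.mem_toFinset, Set.mem_ofPred_eq, Set.mem_ofPred_eq,
        Rat.cast_natCast, Nat.cast_le, Nat.le_floor_iff hy0]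
    rw [h2, Rat.cast_natCast] at h1
    have h3 : (⌊y⌋₊ : ℝ) ^ θ ≤ y ^ θ := by gcongr
    have h4 : 1 ≤ y ^ θ := Real.one_le_rpow hy hθ0
    have h5 := mul_le_mul_of_nonneg_left h3 hC
    have h6 := abs_le.1 h1
    rw [abs_le]
    constructor <;> nlinarith
  · have hq1 : 1 < q := hq
    have hq0 : (0 : ℝ) < q := by positivity
    have hnorm : ∀ m : FreeMon P, ∃ z : ℤ, (normM N m : ℝ) = (q : ℝ) ^ z := fun m => by
      have h1 := hX.1 m
      rw [hXq] at h1
      obtain ⟨z, hz⟩ := h1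
      refine ⟨z, ?_⟩
      have h2 : ((normM N m : ℚ) : ℝ) = (((q : ℚ) ^ z : ℚ) : ℝ) := by rw [hz]
      push_cast at h2
      exact h2
    -- All norms are powers of q, so the count is constant between consecutive powers, and y < q
    -- g(y).
    refine ⟨⟨hN, hfin, κ, C, θ, q, fun y => (q : ℝ) ^ Int.log q y, hκ, hC, hθ0, hθ1, hq0,
      fun m y hy => ?_, fun y hy => Int.zpow_log_le_self hq1 (by linarith), fun y _ => ?_,
      fun y hy => ?_⟩⟩
    · obtain ⟨z, hz⟩ := hnorm m
      rw [hz, log_div_zpow hq1 z hy, zpow_sub₀ hq0.ne']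
    · have h1 := Int.lt_zpow_succ_log_self hq1 y
      rw [zpow_add_one₀ hq0.ne', mul_comm] at h1
      exact h1.le
    · have hy0 : 0 < y := by linarith
      have hle := Int.zpow_log_le_self hq1 hy0
      have h1le : (1 : ℝ) ≤ (q : ℝ) ^ Int.log q y := by
        refine one_le_zpow₀ (by exact_mod_cast hq1.le) ?_
        rw [← Int.zpow_le_iff_le_log hq1 hy0, zpow_zero]
        exact hy
      have hcast : (((q : ℚ) ^ Int.log q y : ℚ) : ℝ) = (q : ℝ) ^ Int.log q y := by push_cast; rfl
      have h1leQ : (1 : ℚ) ≤ (q : ℚ) ^ Int.log q y := by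
        rw [← hcast] at h1le
        exact_mod_cast h1le
      have h1 := hcount ((q : ℚ) ^ Int.log q y) (hXq ▸ ⟨_, rfl⟩) h1leQ
      have h2 : (hfin (((q : ℚ) ^ Int.log q y : ℚ) : ℝ)).toFinset = (hfin y).toFinset := by
        ext m
        obtain ⟨z, hz⟩ := hnorm m
        rw [Set.Finite.mem_toFinset, Set.Finite.mem_toFinset, Set.mem_ofPred_eq,
          Set.mem_ofPred_eq, hcast, hz, zpow_le_zpow_iff_right₀ (by exact_mod_cast hq1),
          Int.zpow_le_iff_le_log hq1 hy0]
      rw [h2, hcast] at h1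
      refine h1.trans ?_
      gcongr

open Classical in
theorem proportion_full (D : RegularNorm N) (k : ℕ) (Q : FreeMon P → Prop) (x : ℚ) :
    proportion N (full P k) Q x =
      (((D.fullBall k x).filter fun m => 3 ≤ normM N m ∧ Q m).card : ℝ) /
        ((D.fullBall k x).card : ℝ) := by
  have h1 : upTo N (full P k) x = (D.fullBall k x : Set (FreeMon P)) := by
    ext m
    rw [Finset.mem_coe, D.mem_fullBall, and_comm, upTo, Set.mem_ofPred_eq]
    norm_cast
  have h2 : {m | m ∈ upTo N (full P k) x ∧ 3 ≤ normM N m ∧ Q m} =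
      ((D.fullBall k x).filter fun m => 3 ≤ normM N m ∧ Q m : Set (FreeMon P)) := by
    ext m
    rw [h1]
    simp
  rw [proportion, h2, h1, Set.ncard_coe_finset, Set.ncard_coe_finset]

theorem tendsto_cast_toInfinity (X : Set ℚ) :
    Tendsto (fun x : ℚ => (x : ℝ)) (toInfinity X) atTop :=
  (tendsto_ratCast_atTop_iff.2 tendsto_id).mono_left inf_le_left

theorem exists_norm_coeff_le {a : ℕ → ℂ} {B β : ℝ} (hB : 0 < B) (hBβ : B ≤ β) (hβ : 1 ≤ β)
    (ha : a =O[atTop] fun i : ℕ => B ^ i) (e : ℂ) :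
    ∃ M : ℝ, ∀ l, ‖e * a l‖ + 1 ≤ M * β ^ l := by
  obtain ⟨C, hC, h⟩ := bound_of_isBigO_nat_atTop ha
  refine ⟨‖e‖ * C + 1, fun l => ?_⟩
  have h1 := h (x := l) (by positivity)
  rw [Real.norm_of_nonneg (by positivity)] at h1
  have h2 : B ^ l ≤ β ^ l := by gcongr
  have h3 : 1 ≤ β ^ l := one_le_pow₀ hβ
  rw [norm_mul, add_mul, one_mul]
  refine add_le_add ?_ h3
  calc ‖e‖ * ‖a l‖ ≤ ‖e‖ * (C * B ^ l) := by gcongr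
    _ ≤ ‖e‖ * (C * β ^ l) := by gcongr
    _ = _ := by ring

end ErdosKac

end

theorem theorem1p7 {P : Type*} [Countable P] (N : P → ℕ) (hN : ∀ p, 1 < N p)
    (X : Set ℚ) (hX : ErdosKac.IsRange N X) (hstar : ErdosKac.LinearGrowth N X)
    (a : ℕ → ℂ) (k : ℕ) (hk : 1 ≤ k) (hak : a k ≠ 0)
    (B α : ℝ) (hα : 0 < α) (hB : 0 < B) (hBα : B ≤ (2 : ℝ) ^ (1 / (k : ℝ) - α))
    (ha : a =O[atTop] fun i : ℕ => B ^ i) :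
    (∀ t : ℝ, Tendsto
      (ErdosKac.proportion N (ErdosKac.full P k)
        fun m => (ErdosKac.normalized N a k m).re ≤ t)
      (ErdosKac.toInfinity X) (𝓝 (ErdosKac.Phi t))) ∧
    (∀ ε : ℝ, 0 < ε → Tendsto
      (ErdosKac.proportion N (ErdosKac.full P k)
        fun m => ε < |(ErdosKac.normalized N a k m).im|)
      (ErdosKac.toInfinity X) (𝓝 0)) := by
  obtain ⟨D⟩ := ErdosKac.nonempty_regularNorm hN hX hstar
  have hk0 : (0 : ℝ) < k := by exact_mod_cast hk
  -- The maximum with 1 lets β^l absorb the additive constant in `hM` without losing β < 2^(1/k).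
  have hβ : max B 1 < (2 : ℝ) ^ (1 / (k : ℝ)) := by
    refine max_lt (hBα.trans_lt ?_) (Real.one_lt_rpow one_lt_two (by positivity))
    exact Real.rpow_lt_rpow_of_exponent_lt one_lt_two (by linarith)
  obtain ⟨M, hM⟩ := ErdosKac.exists_norm_coeff_le hB (le_max_left B 1) (le_max_right B 1) ha
    (1 / a k)
  have hdev := D.tendsto_sum_norm_deviation hk hak hM (lt_max_of_lt_left hB) hβ
  refine ⟨fun t => ?_, fun ε hε => ?_⟩
  · refine ((D.tendsto_card_re_normalized_le hk hdev t).comp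
      (ErdosKac.tendsto_cast_toInfinity X)).congr fun x => ?_
    rw [ErdosKac.proportion_full D, Function.comp_apply]
  · refine ((D.tendsto_card_lt_abs_im_normalized hk hdev hε).comp
      (ErdosKac.tendsto_cast_toInfinity X)).congr fun x => ?_
    rw [ErdosKac.proportion_full D, Function.comp_apply]
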